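/- Let $X$ be a complex Banach space and $A$ the generator of an exponentially stable $C_0$-semigroup $T(\cdot)$ on $X$. Let $\mathcal H^\infty_-$ be the algebra of bounded holomorphic functions on $\mathbb C_-=\{z\in\mathbb C:\operatorname{Re} z<0\}$; each $g\in\mathcal H^\infty_-$ is identified on $i\mathbb R$ with its a.e. boundary function $\lim_{x\to0^-}g(x+i\omega)$. Let $\mathfrak L$ be the Laplace transform, let $\Pi$ be the orthogonal projection of $L^2(i\mathbb R)$ onto the Hardy space $\mathcal H^2=\mathfrak L(L^2(0,\infty))$, and define the Toeplitz operator $M_gf=\mathfrak L^{-1}\Pi(g\cdot\mathfrak Lf)$ on $L^2(0,\infty)$. For $g\in\mathcal H^\infty_-$ let $g(A):D(A)\to X$ be the linear operator, bounded from $D(A)$ with the graph norm to $X$, that satisfies $$M_g\big(\langle y,T(\cdot)x\rangle\big)=\langle y,g(A)T(\cdot)x\rangle\quad\text{in }L^2(0,\infty)\qquad\text{for all }x\in D(A),\ y\in X'$$ (there is exactly one such operator), and let $g_\Lambda(A)$ be its Lambda extension $g_\Lambda(A)x=\lim_{\lambda\to\infty}\lambda\, g(A)R(\lambda,A)x$,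 whose domain is the set of all $x\in X$ for which the limit (along real $\lambda$) exists. Here $R(\lambda,A)=(\lambda I-A)^{-1}$. Then: (i) The set $\mathcal H^{B}=\{g\in\mathcal H^\infty_-: g_\Lambda(A)\in\mathcal B(X)\}$ is a (unital) subalgebra of $\mathcal H^\infty_-$, and $\mathcal H^{B}\to\mathcal B(X)$, $g\mapsto g_\Lambda(A)$, is a (unital) algebra homomorphism. (ii) If $P\in\mathcal B(X)$ commutes with $A$, i.e. $P D(A)\subset D(A)$ and $PAx=APx$ for all $x\in D(A)$, then for every $g\in\mathcal H^\infty_-$ the operator $P$ commutes with $g_\Lambda(A)$ in the same sense, i.e. $P D(g_\Lambda(A))\subset D(g_\Lambda(A))$ and $Pg_\Lambda(A)x=g_\Lambda(A)Px$ for all $x\in D(g_\Lambda(A))$. In particular, every $T(t)$, $t\ge0$, commutes with every $g_\Lambda(A)$. (iii) For every $\mu\in\mathbb C$ with $\operatorname{Re}\mu>0$, $\mu$ lies in the resolvent set of $A$, and for $g_\mu(z)=\frac1{\mu-z}$ one has $g_{\mu,\Lambda}(A)=R(\mu,A)$. (iv) For every $t\ge0$ and $g_t(z)=e^{tz}$ one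 has $g_{t,\Lambda}(A)=T(t)$. -/

import Mathlib

open MeasureTheory Filter Topology Set
open scoped NNReal ENNReal FourierTransform

noncomputable section

namespace HInfCalculus

/-! ### Bounded holomorphic functions on the left half-plane -/

/-- The open left half-plane. -/
abbrev LeftHalfPlane : Type := {z : ℂ // z.re < 0}

/-- Extension by zero of a function on the left half-plane to the whole plane. -/
def extZero (g : LeftHalfPlane → ℂ) (z : ℂ) : ℂ :=
  if h : z.re < 0 then g ⟨z, h⟩ else 0

/-- The algebra of bounded holomorphic functions on the left half-plane, with pointwise
operations. -/
def HInf : Subalgebra ℂ (LeftHalfPlane → ℂ) where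
  carrier := {g | DifferentiableOn ℂ (extZero g) {z : ℂ | z.re < 0} ∧ ∃ c : ℝ, ∀ z, ‖g z‖ ≤ c}
  mul_mem' := by
    rintro f g ⟨hf, c, hc⟩ ⟨hg, d, hd⟩
    refine ⟨(hf.mul hg).congr ?_, c * d, fun z => ?_⟩
    · intro z hz
      have hz' : z.re < 0 := hz
      simp [extZero, hz']
    · rw [Pi.mul_apply, norm_mul]
      exact mul_le_mul (hc z) (hd z) (norm_nonneg _) ((norm_nonneg _).trans (hc z))
  add_mem' := by
    rintro f g ⟨hf, c, hc⟩ ⟨hg, d, hd⟩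
    refine ⟨(hf.add hg).congr ?_, c + d, fun z => ?_⟩
    · intro z hz
      have hz' : z.re < 0 := hz
      simp [extZero, hz']
    · exact (norm_add_le _ _).trans (add_le_add (hc z) (hd z))
  algebraMap_mem' := by
    intro r
    refine ⟨(differentiableOn_const r).congr ?_, ‖r‖, fun z => le_of_eq rfl⟩
    intro z hz
    have hz' : z.re < 0 := hz
    simp [extZero, hz']

/-- The function `z ↦ 1 / (μ - z)` for `Re μ > 0`. -/
def resolventSymbol (μ : ℂ) (hμ : 0 < μ.re) : HInf :=
  ⟨fun z => 1 / (μ - z.1), by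
    have hne : ∀ z : ℂ, z.re < 0 → μ.re ≤ ‖μ - z‖ := fun z hz => by
      have h1 := Complex.re_le_norm (μ - z)
      rw [Complex.sub_re] at h1
      linarith
    constructor
    · have h : DifferentiableOn ℂ (fun z : ℂ => 1 / (μ - z)) {z : ℂ | z.re < 0} := by
        refine (differentiableOn_const 1).div
          ((differentiableOn_const μ).sub differentiableOn_id) ?_
        intro z hz h0
        have := hne z hz
        rw [show μ - z = 0 from h0, norm_zero] at this
        linarith
      refine h.congr ?_
      intro z hz
      have hz' : z.re < 0 := hz
      simp [extZero, hz']
    · refine ⟨1 / μ.re, fun z => ?_⟩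
      rw [norm_div, norm_one]
      exact one_div_le_one_div_of_le hμ (hne z.1 z.2)⟩

/-- The function `z ↦ exp (t z)` for `t ≥ 0`. -/
def expSymbol (t : ℝ≥0) : HInf :=
  ⟨fun z => Complex.exp (((t : ℝ) : ℂ) * z.1), by
    constructor
    · have h : DifferentiableOn ℂ (fun z : ℂ => Complex.exp (((t : ℝ) : ℂ) * z))
          {z : ℂ | z.re < 0} := by fun_prop
      refine h.congr ?_
      intro z hz
      have hz' : z.re < 0 := hz
      simp [extZero, hz']
    · refine ⟨1, fun z => ?_⟩
      rw [Complex.norm_exp, Real.exp_le_one_iff, Complex.re_ofReal_mul]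
      exact mul_nonpos_of_nonneg_of_nonpos t.2 z.2.le⟩

/-! ### Boundary functions -/

/-- The boundary function `ω ↦ lim_{x → 0-} g (x + i ω)` of a function on the left half-plane
(with the value `0` where the limit does not exist, which for bounded holomorphic `g` happens only
on a null set). -/
def boundaryFun (g : LeftHalfPlane → ℂ) (ω : ℝ) : ℂ :=
  open Classical in
  if ∃ l : ℂ, Tendsto (fun x : ℝ => extZero g (x + ω * Complex.I)) (𝓝[<] 0) (𝓝 l)
  then limUnder (𝓝[<] 0) (fun x : ℝ => extZero g (x + ω * Complex.I)) else 0

theorem norm_boundaryFun_le (g : LeftHalfPlane → ℂ) (c : ℝ) (hc : ∀ z, ‖g z‖ ≤ c) (ω : ℝ) :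
    ‖boundaryFun g ω‖ ≤ max c 0 := by
  unfold boundaryFun
  split_ifs with h
  · refine le_of_tendsto (tendsto_nhds_limUnder h).norm (Eventually.of_forall fun x => ?_)
    unfold extZero
    split_ifs
    · exact (hc _).trans (le_max_left _ _)
    · simp
  · simp

theorem continuous_extZero_line (g : HInf) (x : ℝ) (hx : x < 0) :
    Continuous fun ω : ℝ => extZero g.1 (x + ω * Complex.I) := by
  refine g.2.1.continuousOn.comp_continuous (by fun_prop) fun ω => ?_
  simpa using hx

theorem measurable_boundaryFun (g : HInf) : Measurable (boundaryFun g.1) := by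
  -- a null sequence of negative reals, and the oscillation over `(-u n, 0)`
  obtain ⟨u, -, hu, hlim⟩ := exists_seq_strictMono_tendsto' (show (-1 : ℝ) < 0 by norm_num)
  let φ : ℝ → ℝ → ℂ := fun x ω => extZero g.1 (x + ω * Complex.I)
  let U : ℕ → ℝ → ℝ≥0∞ := fun n ω =>
    ⨆ x ∈ Ioo (u n) 0, ⨆ x' ∈ Ioo (u n) 0, edist (φ x ω) (φ x' ω)
  have hU : ∀ n, Measurable (U n) := fun n => by
    refine (lowerSemicontinuous_biSup fun x hx => lowerSemicontinuous_biSup fun x' hx' =>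
      ?_).measurable
    exact ((continuous_extZero_line g x hx.2).edist
      (continuous_extZero_line g x' hx'.2)).lowerSemicontinuous
  have hS : {ω : ℝ | ∃ l : ℂ, Tendsto (fun x : ℝ => φ x ω) (𝓝[<] 0) (𝓝 l)}
      = {ω : ℝ | ⨅ n, U n ω = 0} := by
    ext ω
    simp only [mem_ofPred_eq]
    rw [← cauchy_map_iff_exists_tendsto, EMetric.cauchy_iff]
    constructor
    · rintro ⟨-, h⟩
      refine le_antisymm (le_of_forall_pos_le_add fun ε hε => ?_) bot_le
      obtain ⟨t, ht, hte⟩ := h ε hε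
      rw [mem_map] at ht
      obtain ⟨a, ha, hat⟩ := (mem_nhdsLT_iff_exists_Ioo_subset).1 ht
      obtain ⟨n, hn⟩ := (hlim.eventually (lt_mem_nhds (show a < 0 from ha))).exists
      rw [zero_add]
      refine (iInf_le _ n).trans (iSup₂_le fun x hx => iSup₂_le fun x' hx' => ?_)
      exact (hte _ (hat ⟨hn.trans hx.1, hx.2⟩) _ (hat ⟨hn.trans hx'.1, hx'.2⟩)).le
    · intro h
      refine ⟨NeBot.ne inferInstance, fun ε hε => ?_⟩
      obtain ⟨n, hn⟩ := iInf_lt_iff.1 (h.trans_lt hε)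
      refine ⟨(fun x => φ x ω) '' Ioo (u n) 0,
        image_mem_map (Ioo_mem_nhdsLT (hu n).2), ?_⟩
      rintro _ ⟨x, hx, rfl⟩ _ ⟨x', hx', rfl⟩
      refine lt_of_le_of_lt ?_ hn
      exact (le_iSup₂ (f := fun x' (_ : x' ∈ Ioo (u n) 0) => edist (φ x ω) (φ x' ω)) x' hx').trans
        (le_iSup₂ (f := fun x (_ : x ∈ Ioo (u n) 0) =>
          ⨆ x' ∈ Ioo (u n) 0, edist (φ x ω) (φ x' ω)) x hx)
  have hSm : MeasurableSet {ω : ℝ | ∃ l : ℂ, Tendsto (fun x : ℝ => φ x ω) (𝓝[<] 0) (𝓝 l)} := by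
    rw [hS]
    exact measurableSet_eq_fun (Measurable.iInf hU) measurable_const
  have hu' : Tendsto u atTop (𝓝[<] 0) :=
    tendsto_nhdsWithin_iff.2 ⟨hlim, Eventually.of_forall fun n => (hu n).2⟩
  refine measurable_of_tendsto_metrizable (f := fun n =>
    indicator {ω : ℝ | ∃ l : ℂ, Tendsto (fun x : ℝ => φ x ω) (𝓝[<] 0) (𝓝 l)} (φ (u n)))
    (fun n => (continuous_extZero_line g (u n) (hu n).2).measurable.indicator hSm) ?_
  rw [tendsto_pi_nhds]
  intro ω
  unfold boundaryFun
  split_ifs with h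
  · have h' : ω ∈ {ω : ℝ | ∃ l : ℂ, Tendsto (fun x : ℝ => φ x ω) (𝓝[<] 0) (𝓝 l)} := h
    simp only [indicator_of_mem h']
    exact (tendsto_nhds_limUnder h).comp hu'
  · have h' : ω ∉ {ω : ℝ | ∃ l : ℂ, Tendsto (fun x : ℝ => φ x ω) (𝓝[<] 0) (𝓝 l)} := h
    simp only [indicator_of_notMem h']
    exact tendsto_const_nhds

theorem memLp_boundaryFun (g : HInf) :
    MemLp (fun ξ : ℝ => boundaryFun g.1 (2 * Real.pi * ξ)) ∞ volume := by
  obtain ⟨c, hc⟩ := g.2.2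
  exact memLp_top_of_bound
    ((measurable_boundaryFun g).comp (measurable_const_mul _)).aestronglyMeasurable
    (max c 0) (Eventually.of_forall fun ξ => norm_boundaryFun_le g.1 c hc _)

/-- The boundary function of `g` as an element of `L^∞`, the imaginary axis being parametrized by
`ξ ↦ 2 π i ξ`. -/
def boundary (g : HInf) : Lp ℂ ∞ (volume : Measure ℝ) := (memLp_boundaryFun g).toLp _

/-! ### The Toeplitz operator -/

/-- The space `L²(0,∞)`, as the closed subspace of those elements of `L²(ℝ)` which vanish almost
everywhere on `(-∞, 0]`. -/
def L2pos : Submodule ℂ (Lp ℂ 2 (volume : Measure ℝ)) :=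
  (LpToLpRestrictCLM ℝ ℂ ℂ volume 2 (Iic 0)).ker

instance : CompleteSpace L2pos :=
  (LpToLpRestrictCLM ℝ ℂ ℂ volume 2 (Iic 0)).isClosed_ker.completeSpace_coe

theorem mem_L2pos_iff (f : Lp ℂ 2 (volume : Measure ℝ)) :
    f ∈ L2pos ↔ f =ᵐ[volume.restrict (Iic (0 : ℝ))] 0 := by
  rw [L2pos, LinearMap.mem_ker]
  constructor
  · intro h
    exact (LpToLpRestrictCLM_coeFn ℂ (Iic 0) f).symm.trans
      ((Lp.eq_zero_iff_ae_eq_zero).1 h)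
  · intro h
    exact (Lp.eq_zero_iff_ae_eq_zero).2 ((LpToLpRestrictCLM_coeFn ℂ (Iic 0) f).trans h)

/-- The Hardy space `H²` on the right half-plane, identified with its space of boundary functions:
the image of `L²(0,∞)` under the Laplace transform. On the imaginary axis, parametrized by
`s = 2 π i ξ`, the Laplace transform `∫ exp (- s t) f t dt` is the Fourier transform
`∫ exp (- 2 π i ξ t) f t dt`. -/
def H2 : Submodule ℂ (Lp ℂ 2 (volume : Measure ℝ)) :=
  L2pos.map (Lp.fourierTransformₗᵢ ℝ ℂ).toLinearEquiv.toLinearMap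

/-- The Laplace transform as an isometric isomorphism from `L²(0,∞)` onto `H²`. -/
def laplace : L2pos ≃ₗᵢ[ℂ] H2 := (Lp.fourierTransformₗᵢ ℝ ℂ).submoduleMap L2pos

instance : H2.HasOrthogonalProjection :=
  Submodule.HasOrthogonalProjection.map_linearIsometryEquiv L2pos (Lp.fourierTransformₗᵢ ℝ ℂ)

/-- The Toeplitz operator `M_g f = 𝔏⁻¹ Π (g · 𝔏 f)` on `L²(0,∞)`, where `Π` is the orthogonal
projection of `L²` of the imaginary axis onto `H²`. -/
def toeplitz (g : HInf) (f : L2pos) : L2pos :=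
  laplace.symm (H2.orthogonalProjectionOnto
    (boundary g • (laplace f : Lp ℂ 2 (volume : Measure ℝ)) : Lp ℂ 2 (volume : Measure ℝ)))

/-! ### Semigroups, generators, resolvents -/

variable {X : Type*} [NormedAddCommGroup X] [NormedSpace ℂ X]

variable (X) in
/-- A strongly continuous one-parameter semigroup of bounded operators. -/
structure C0Semigroup where
  /-- The operators of the semigroup. -/
  op : ℝ≥0 → X →L[ℂ] X
  op_zero : op 0 = 1
  op_add : ∀ s t, op (s + t) = op s * op t
  continuous_orbit : ∀ x, Continuous fun t => op t x

/-- Exponential stability: `‖T(t)‖ ≤ M exp (ω t)` for some `ω < 0`. -/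
def C0Semigroup.IsExpStable (T : C0Semigroup X) : Prop :=
  ∃ M ω : ℝ, ω < 0 ∧ ∀ t : ℝ≥0, ‖T.op t‖ ≤ M * Real.exp (ω * t)

/-- The generator `A x = lim_{h → 0+} (T(h) x - x) / h`, with domain `D(A)` the set of all `x` for
which the limit exists. -/
def C0Semigroup.generator (T : C0Semigroup X) : X →ₗ.[ℂ] X where
  domain :=
    { carrier := {x | ∃ z, Tendsto (fun h : ℝ≥0 => ((h : ℝ) : ℂ)⁻¹ • (T.op h x - x))
        (𝓝[>] 0) (𝓝 z)}
      add_mem' := by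
        rintro x y ⟨z, hz⟩ ⟨w, hw⟩
        refine ⟨z + w, (hz.add hw).congr fun h => ?_⟩
        rw [map_add, ← smul_add]
        congr 1
        abel
      zero_mem' := ⟨0, by simp⟩
      smul_mem' := by
        rintro c x ⟨z, hz⟩
        refine ⟨c • z, (hz.const_smul c).congr fun h => ?_⟩
        rw [map_smul, ← smul_sub, smul_comm] }
  toFun :=
    { toFun := fun x => limUnder (𝓝[>] 0) fun h : ℝ≥0 => ((h : ℝ) : ℂ)⁻¹ • (T.op h x.1 - x.1)
      map_add' := by
        rintro ⟨x, hx⟩ ⟨y, hy⟩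
        refine Tendsto.limUnder_eq
          (((tendsto_nhds_limUnder hx).add (tendsto_nhds_limUnder hy)).congr fun h => ?_)
        simp only [Submodule.coe_add, map_add]
        rw [← smul_add]
        congr 1
        abel
      map_smul' := by
        rintro c ⟨x, hx⟩
        refine Tendsto.limUnder_eq (((tendsto_nhds_limUnder hx).const_smul c).congr fun h => ?_)
        simp only [Submodule.coe_smul, map_smul]
        rw [← smul_sub, smul_comm] }

theorem C0Semigroup.op_mem_domain (T : C0Semigroup X) (t : ℝ≥0) (x : T.generator.domain) :
    T.op t x ∈ T.generator.domain := by
  obtain ⟨x, z, hz⟩ := x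
  refine ⟨T.op t z, (((T.op t).continuous.tendsto z).comp hz).congr fun h => ?_⟩
  have : T.op t (T.op h x) = T.op h (T.op t x) := by
    rw [← mul_apply_eq_comp, ← mul_apply_eq_comp, ← T.op_add,
      ← T.op_add, add_comm]
  simp only [Function.comp_apply, map_smul, map_sub, this]

/-- The operator `μ - A : D(A) → X`. -/
def subOp (A : X →ₗ.[ℂ] X) (μ : ℂ) : A.domain →ₗ[ℂ] X := μ • A.domain.subtype - A.toFun

/-- The resolvent set: all `μ` such that `μ - A : D(A) → X` is bijective with bounded inverse. -/
def resSet (A : X →ₗ.[ℂ] X) : Set ℂ :=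
  {μ | Function.Bijective (subOp A μ) ∧ ∃ c : ℝ, ∀ x : A.domain, ‖(x : X)‖ ≤ c * ‖subOp A μ x‖}

/-- The resolvent `R(μ, A) = (μ - A)⁻¹ : X → D(A)` for `μ` in the resolvent set
(and `0` for all other `μ`). -/
def res (A : X →ₗ.[ℂ] X) (μ : ℂ) : X →ₗ[ℂ] A.domain :=
  open Classical in
  if h : μ ∈ resSet A then (LinearEquiv.ofBijective (subOp A μ) h.1).symm.toLinearMap else 0

/-- The Lambda extension `C_Λ x = lim_{s → ∞} s C R(s, A) x` of an operator `C : D(A) → X`, with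
domain the set of all `x` for which the limit exists. -/
def lambdaExt (A : X →ₗ.[ℂ] X) (C : A.domain →ₗ[ℂ] X) : X →ₗ.[ℂ] X where
  domain :=
    { carrier := {x | ∃ z, Tendsto (fun s : ℝ => (s : ℂ) • C (res A s x)) atTop (𝓝 z)}
      add_mem' := by
        rintro x y ⟨z, hz⟩ ⟨w, hw⟩
        exact ⟨z + w, (hz.add hw).congr fun s => by simp only [map_add, smul_add]⟩
      zero_mem' := ⟨0, by simp⟩
      smul_mem' := by
        rintro c x ⟨z, hz⟩
        exact ⟨c • z, (hz.const_smul c).congr fun s => by simp only [map_smul]; rw [smul_comm]⟩ }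
  toFun :=
    { toFun := fun x => limUnder atTop fun s : ℝ => (s : ℂ) • C (res A s x.1)
      map_add' := by
        rintro ⟨x, hx⟩ ⟨y, hy⟩
        exact Tendsto.limUnder_eq (((tendsto_nhds_limUnder hx).add
          (tendsto_nhds_limUnder hy)).congr fun s => by
            simp only [Submodule.coe_add, map_add, smul_add])
      map_smul' := by
        rintro c ⟨x, hx⟩
        exact Tendsto.limUnder_eq (((tendsto_nhds_limUnder hx).const_smul c).congr fun s => by
          simp only [Submodule.coe_smul, map_smul]; rw [smul_comm]) }

/-- A bounded operator, regarded as an unbounded operator with domain the whole space. -/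
def ofBounded (P : X →L[ℂ] X) : X →ₗ.[ℂ] X := P.toLinearMap.toPMap ⊤

/-- The bounded operator `P` commutes with the unbounded operator `F`, i.e. `P F ⊆ F P`:
`P` maps the domain of `F` into itself and `F P x = P F x` there. -/
def CommutesWith (P : X →L[ℂ] X) (F : X →ₗ.[ℂ] X) : Prop :=
  ∀ x : F.domain, ∃ h : P x ∈ F.domain, F ⟨P x, h⟩ = P (F x)

/-! ### The calculus -/

/-- The scalar function `t ↦ ⟨y, T(t) x⟩` on `(0,∞)`, extended by zero. -/
def orbitFun (T : C0Semigroup X) (x : X) (y : StrongDual ℂ X) : ℝ → ℂ :=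
  indicator (Ioi 0) fun t => y (T.op t.toNNReal x)

theorem memLp_orbitFun {T : C0Semigroup X} (hT : T.IsExpStable) (x : X) (y : StrongDual ℂ X) :
    MemLp (orbitFun T x y) 2 volume := by
  obtain ⟨M, ω, hω, hM⟩ := hT
  have hc : Continuous fun t : ℝ => y (T.op t.toNNReal x) :=
    y.continuous.comp ((T.continuous_orbit x).comp continuous_real_toNNReal)
  have hm : AEStronglyMeasurable (fun t : ℝ => y (T.op t.toNNReal x))
      (volume.restrict (Ioi 0)) := hc.aestronglyMeasurable
  unfold orbitFun
  rw [memLp_indicator_iff_restrict measurableSet_Ioi, memLp_two_iff_integrable_sq_norm hm]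
  have hi : Integrable (fun t : ℝ => (‖y‖ * M * ‖x‖) ^ 2 * Real.exp (2 * ω * t))
      (volume.restrict (Ioi 0)) :=
    (integrableOn_exp_mul_Ioi (by linarith) 0).const_mul _
  refine hi.mono' (hm.norm.pow 2) ?_
  filter_upwards [ae_restrict_mem measurableSet_Ioi] with t ht
  have ht' : ((t.toNNReal : ℝ≥0) : ℝ) = t := Real.coe_toNNReal t (le_of_lt ht)
  have h1 : ‖y (T.op t.toNNReal x)‖ ≤ ‖y‖ * M * ‖x‖ * Real.exp (ω * t) := by
    calc ‖y (T.op t.toNNReal x)‖ ≤ ‖y‖ * (‖T.op t.toNNReal‖ * ‖x‖) :=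
          (y.le_opNorm _).trans (by gcongr; exact (T.op _).le_opNorm x)
      _ ≤ ‖y‖ * ((M * Real.exp (ω * t)) * ‖x‖) := by
          have := hM t.toNNReal
          rw [ht'] at this
          gcongr
      _ = _ := by ring
  rw [Real.norm_eq_abs, abs_of_nonneg (by positivity)]
  calc ‖y (T.op t.toNNReal x)‖ ^ 2 ≤ (‖y‖ * M * ‖x‖ * Real.exp (ω * t)) ^ 2 := by gcongr
    _ = _ := by rw [mul_pow, ← Real.exp_nat_mul]; congr 2; push_cast; ring

/-- The function `t ↦ ⟨y, T(t) x⟩` as an element of `L²(0,∞)`. -/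
def orbit {T : C0Semigroup X} (hT : T.IsExpStable) (x : X) (y : StrongDual ℂ X) : L2pos :=
  ⟨(memLp_orbitFun hT x y).toLp _, by
    rw [mem_L2pos_iff]
    filter_upwards [ae_restrict_of_ae (memLp_orbitFun hT x y).coeFn_toLp,
      ae_restrict_mem measurableSet_Iic] with t h1 h2
    rw [h1]
    simp only [orbitFun, Pi.zero_apply]
    exact indicator_of_notMem (by simpa using h2) _⟩

/-- The property characterizing the operator `g(A) : D(A) → X`: it is linear, bounded for the graph
norm, and `M_g ⟨y, T(·) x⟩ = ⟨y, g(A) T(·) x⟩` in `L²(0,∞)` for all `x ∈ D(A)` and `y ∈ X'`. -/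
def IsCalculusOp {T : C0Semigroup X} (hT : T.IsExpStable) (g : HInf)
    (C : T.generator.domain →ₗ[ℂ] X) : Prop :=
  (∃ c : ℝ, ∀ x : T.generator.domain, ‖C x‖ ≤ c * (‖(x : X)‖ + ‖T.generator x‖)) ∧
  ∀ (x : T.generator.domain) (y : StrongDual ℂ X),
    ((toeplitz g (orbit hT x y) : Lp ℂ 2 (volume : Measure ℝ)) : ℝ → ℂ)
      =ᵐ[volume.restrict (Ioi 0)]
    fun t => y (C ⟨T.op t.toNNReal x, T.op_mem_domain t.toNNReal x⟩)

/-- The operator `g(A) : D(A) → X`: the operator with the characterizing property above. -/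
def calculusOp {T : C0Semigroup X} (hT : T.IsExpStable) (g : HInf) :
    T.generator.domain →ₗ[ℂ] X :=
  Classical.epsilon (IsCalculusOp hT g)

/-- The operator `g_Λ(A)`: the Lambda extension of `g(A)`. -/
def calculus {T : C0Semigroup X} (hT : T.IsExpStable) (g : HInf) : X →ₗ.[ℂ] X :=
  lambdaExt T.generator (calculusOp hT g)

end HInfCalculus

end

open HInfCalculus

noncomputable section

namespace HInfCalculus

/-! ### Functions on the left half-plane with quadratic decay -/

/-! Everything is read off from the Toeplitz operators `M_g` acting on the orbit functions `t ↦ ⟨y,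
T(t)x⟩`. The symbol `e^{tz}` acts on `L²(0,∞)` as left translation followed by restriction, and left
translation sends the orbit of `x` to the orbit of `T(t)x`. Hence a symbol `g(z) = ∫ ψ(t) e^{tz} dt`
with bounded density `ψ` sends the orbit of `x` to the orbit of `∫ ψ(t) T(t)x dt`
(`toeplitz_orbit`). The choice `ψ(t) = e^{-μt}` gives the resolvent. A function on the left
half-plane with quadratic decay along vertical lines always has such a density, by contour shifting
and Fourier inversion (`exists_laplace_density`).

A general `g` is reduced to this case by the factor `(1 - z)⁻²`. It yields a bounded operator `C₀`
that plays the role of `g(A)R(1,A)²`. Boundedness of `M_g` on `L²`, together with the fact that `⟨y,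
R(1,A)x⟩` is an `L²` inner product with the orbit, bounds `C₀R(1,A)z` by `R(1,A)²z`. So one factor
of the resolvent can be removed: there is a bounded `B` with `BR(1,A) = C₀`
(`exists_regularized_op`), and `g(A) = B(1 - A)`. Uniqueness holds because both sides of the
defining identity have continuous representatives, which may be compared at `t = 0`.

Products rest on `M_{fg} = M_f M_g` (`toeplitz_mul`): multiplication by a bounded holomorphic
function on the left half-plane preserves the orthogonal complement of `H²`. Multiplicativity of the
boundary functions themselves needs Fatou's theorem (`ae_exists_tendsto_extZero`). It is obtained by
writing `g` through the derivative of a Lipschitz function `W` with quadratic decay, reproducing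
`W'` from the values of `W` on a vertical line, and applying Rademacher's theorem to the boundary
values of `W`.

Finally `sR(s,A)x → x`, so `g_Λ(A)` is a bounded operator `P` exactly when `g(A)` is the restriction
of `P` to `D(A)` (`calculus_eq_ofBounded_iff`). Each identity of the calculus then becomes an
identity between Toeplitz operators on orbits. Commutation passes through the limit that defines the
Lambda extension. That an operator commuting with `A` commutes with `T(t)` follows from its
commuting with the resolvents and from uniqueness of the Fourier transform. -/

theorem isOpen_leftHalfPlane : IsOpen {z : ℂ | z.re < 0} :=
  isOpen_lt Complex.continuous_re continuous_const

theorem convex_leftHalfPlane : Convex ℝ {z : ℂ | z.re < 0} :=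
  convex_halfSpace_re_lt 0

theorem integrable_vertical {F : ℂ → ℂ} (hF : ContinuousOn F {z : ℂ | z.re < 0}) {x C : ℝ}
    (hx : x < 0) (h : ∀ y : ℝ, ‖F (x + y * Complex.I)‖ ≤ C * (1 + y ^ 2)⁻¹) :
    Integrable fun y : ℝ => F (x + y * Complex.I) := by
  refine (integrable_inv_one_add_sq.const_mul C).mono' ?_ (Eventually.of_forall h)
  refine (hF.comp_continuous (by fun_prop) fun y => ?_).aestronglyMeasurable
  simpa using hx

/-- Cauchy's theorem on the rectangle between the two lines with heights `±R`: the quadratic decay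
makes the horizontal sides vanish as `R → ∞`. -/
theorem integral_vertical_eq {F : ℂ → ℂ} (hF : DifferentiableOn ℂ F {z : ℂ | z.re < 0})
    {a b C : ℝ} (ha : a < 0) (hb : b < 0)
    (h : ∀ z : ℂ, min a b ≤ z.re → z.re < 0 → ‖F z‖ ≤ C * (1 + z.im ^ 2)⁻¹) :
    ∫ y : ℝ, F (a + y * Complex.I) = ∫ y : ℝ, F (b + y * Complex.I) := by
  have hint : ∀ x : ℝ, min a b ≤ x → x < 0 → Integrable fun y : ℝ => F (x + y * Complex.I) :=
    fun x h1 h2 => integrable_vertical hF.continuousOn h2 fun y => by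
      simpa using h (x + y * Complex.I) (by simpa using h1) (by simpa using h2)
  have hlim : ∀ x : ℝ, min a b ≤ x → x < 0 →
      Tendsto (fun R : ℝ => ∫ y in (-R)..R, F (x + y * Complex.I)) atTop
        (𝓝 (∫ y : ℝ, F (x + y * Complex.I))) := fun x h1 h2 =>
    intervalIntegral_tendsto_integral (hint x h1 h2) tendsto_neg_atTop_atBot tendsto_id
  have hmax : max a b < 0 := max_lt ha hb
  -- The sign `s = ±1` treats the upper and the lower side together.
  have hhor : ∀ s : ℝ, |s| = 1 → Tendsto (fun R : ℝ => ∫ x in a..b, F (x + (s * R : ℝ) * Complex.I))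
      atTop (𝓝 0) := by
    intro s hs
    have hs2 : s ^ 2 = 1 := by rw [← sq_abs, hs, one_pow]
    have h0 : Tendsto (fun R : ℝ => C * (1 + R ^ 2)⁻¹ * |b - a|) atTop (𝓝 0) := by
      have : Tendsto (fun R : ℝ => (1 + R ^ 2)⁻¹) atTop (𝓝 0) :=
        tendsto_inv_atTop_zero.comp
          (tendsto_atTop_add_const_left _ _ (tendsto_pow_atTop two_ne_zero))
      simpa using (this.const_mul C).mul_const |b - a|
    refine squeeze_zero_norm (fun R => ?_) h0
    refine intervalIntegral.norm_integral_le_of_norm_le_const fun x hx => ?_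
    have := h (x + (s * R : ℝ) * Complex.I) (by simpa using hx.1.le)
      (by simpa using hx.2.trans_lt hmax)
    simpa [mul_pow, hs2] using this
  have key : ∀ R : ℝ, (∫ x in a..b, F (x + ((-1) * R : ℝ) * Complex.I))
      - (∫ x in a..b, F (x + (1 * R : ℝ) * Complex.I))
      + Complex.I • (∫ y in (-R)..R, F (b + y * Complex.I))
      - Complex.I • (∫ y in (-R)..R, F (a + y * Complex.I)) = 0 := by
    intro R
    have := Complex.integral_boundary_rect_eq_zero_of_differentiableOn F
      (a + (-R : ℝ) * Complex.I) (b + (R : ℝ) * Complex.I) (hF.mono fun z hz => ?_)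
    · simpa using this
    · have : z.re ∈ uIcc a b := by simpa using hz.1
      exact this.2.trans_lt hmax
  have h1 := ((hhor (-1) (by simp)).sub (hhor 1 (by simp))).add
    ((hlim b (min_le_right _ _) hb).const_smul Complex.I)
  have h2 := h1.sub ((hlim a (min_le_left _ _) ha).const_smul Complex.I)
  have h3 := tendsto_nhds_unique (h2.congr key) tendsto_const_nhds
  rw [sub_zero, zero_add, ← smul_sub, smul_eq_zero, sub_eq_zero] at h3
  exact (h3.resolve_left Complex.I_ne_zero).symm

theorem cexp_mul_norm (z : ℂ) (t : ℝ) : ‖Complex.exp (z * t)‖ = Real.exp (z.re * t) := by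
  rw [Complex.norm_exp, Complex.re_mul_ofReal]

/-- A holomorphic function with quadratic decay on the left half-plane is a Laplace integral with
a bounded density. -/
theorem exists_laplace_density {k : ℂ → ℂ} (hk : DifferentiableOn ℂ k {z : ℂ | z.re < 0}) {c : ℝ}
    (hc : ∀ z : ℂ, z.re < 0 → ‖k z‖ ≤ c * (1 + z.im ^ 2)⁻¹) :
    ∃ ψ : ℝ → ℂ, Continuous ψ ∧ (∃ C : ℝ, ∀ t, ‖ψ t‖ ≤ C) ∧
      ∀ z : ℂ, z.re < 0 → k z = ∫ t in Ioi 0, ψ t * Complex.exp (z * t) := by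
  have hc0 : 0 ≤ c := by
    have := (norm_nonneg _).trans (hc (-1) (by simp))
    simpa using this
  -- `J x t` is the inverse Laplace integral along `Re z = x`, up to the factor `2π`. It does not
  -- depend on `x`, so the line may be moved to suit the sign of `t`.
  let J : ℝ → ℝ → ℂ := fun x t =>
    ∫ y : ℝ, k (x + y * Complex.I) * Complex.exp (-(x + y * Complex.I) * t)
  have hJeq : ∀ x t, x < 0 → J x t = J (-1) t := by
    intro x t hx
    have hF : DifferentiableOn ℂ (fun z => k z * Complex.exp (-z * t)) {z : ℂ | z.re < 0} :=
      hk.mul (by fun_prop)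
    have := integral_vertical_eq hF (C := c * Real.exp (max 0 (-min x (-1) * t))) hx
      (show (-1 : ℝ) < 0 by norm_num) ?_
    · simpa [J] using this
    intro z h1 h2
    rw [norm_mul, cexp_mul_norm, mul_right_comm]
    refine mul_le_mul (hc z h2) (Real.exp_le_exp.2 ?_) (Real.exp_nonneg _)
      ((norm_nonneg _).trans (hc z h2))
    rcases le_total 0 t with ht | ht
    · refine le_max_of_le_right ?_
      rw [Complex.neg_re]
      exact mul_le_mul_of_nonneg_right (neg_le_neg h1) ht
    · refine le_max_of_le_left ?_
      rw [Complex.neg_re]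
      exact mul_nonpos_of_nonneg_of_nonpos (by linarith) ht
  have hJ : ∀ x t, x < 0 → ‖J x t‖ ≤ c * Real.pi * Real.exp (-x * t) := by
    intro x t hx
    have : ∫ y : ℝ, c * (1 + y ^ 2)⁻¹ * Real.exp (-x * t) = c * Real.pi * Real.exp (-x * t) := by
      rw [integral_mul_const, integral_const_mul, integral_univ_inv_one_add_sq]
    rw [← this]
    refine norm_integral_le_of_norm_le
      ((integrable_inv_one_add_sq.const_mul c).mul_const _) (Eventually.of_forall fun y => ?_)
    rw [norm_mul, cexp_mul_norm]
    have := hc (x + y * Complex.I) (by simpa using hx)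
    simp only [Complex.neg_re, Complex.add_re, Complex.ofReal_re, Complex.mul_re, Complex.I_re,
      mul_zero, Complex.ofReal_im, Complex.I_im, mul_one, sub_self, add_zero]
    gcongr
    simpa using this
  let f : ℝ → ℝ → ℂ := fun x ξ => k (x + (2 * Real.pi * ξ : ℝ) * Complex.I)
  have hfi : ∀ x, x < 0 → Integrable (f x) := fun x hx =>
    (integrable_vertical hk.continuousOn hx (C := c) fun y => by
      simpa using hc (x + y * Complex.I) (by simpa using hx)).comp_mul_left' (R := 2 * Real.pi)
      Real.two_pi_pos.ne'
  have hfc : ∀ x, x < 0 → Continuous (f x) := fun x hx =>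
    hk.continuousOn.comp_continuous (by fun_prop) fun y => by simpa using hx
  have hFJ : ∀ x t, 𝓕 (f x) t = (2 * Real.pi)⁻¹ * Complex.exp (x * t) * J x t := by
    intro x t
    rw [Real.fourier_real_eq_integral_exp_smul]
    have := Measure.integral_comp_mul_left (fun y : ℝ => Complex.exp (x * t) *
      (k (x + y * Complex.I) * Complex.exp (-(x + y * Complex.I) * t))) (2 * Real.pi)
    rw [integral_const_mul, integral_const_mul, abs_of_pos (inv_pos.2 Real.two_pi_pos),
      Complex.real_smul] at this
    simp only [J]
    rw [mul_assoc, ← this, ← integral_const_mul]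
    refine integral_congr_ae (Eventually.of_forall fun ξ => ?_)
    simp only [f, smul_eq_mul]
    rw [mul_comm (k _), ← mul_assoc, ← Complex.exp_add]
    push_cast
    congr 2
    ring
  let ψ : ℝ → ℂ := fun t => (2 * Real.pi)⁻¹ * J (-1) t
  have hψF : ∀ x t, x < 0 → 𝓕 (f x) t = ψ t * Complex.exp (x * t) := by
    intro x t hx
    rw [hFJ, hJeq x t hx]
    simp only [ψ]
    ring
  -- For `t < 0` the bound on `J x t` tends to zero as the line moves to `Re z = -∞`.
  have hψneg : ∀ t < 0, ψ t = 0 := by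
    intro t ht
    have hlim : Tendsto (fun x : ℝ => c * Real.pi * Real.exp (-x * t)) atBot (𝓝 0) := by
      have : Tendsto (fun x : ℝ => -x * t) atBot atBot :=
        tendsto_neg_atBot_atTop.atTop_mul_const_of_neg ht
      simpa using (Real.tendsto_exp_atBot.comp this).const_mul (c * Real.pi)
    have : ‖J (-1) t‖ ≤ 0 := ge_of_tendsto hlim (by
      filter_upwards [eventually_lt_atBot 0] with x hx
      rw [← hJeq x t hx]
      exact hJ x t hx)
    simp only [ψ, norm_le_zero_iff.1 this, mul_zero]
  have hψc : Continuous ψ := by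
    have : ψ = fun t : ℝ => 𝓕 (f (-1)) t * Complex.exp t := by
      ext t
      rw [hψF (-1) t (by norm_num), mul_assoc, ← Complex.exp_add]
      simp
    rw [this]
    refine Continuous.mul ?_ (by fun_prop)
    exact VectorFourier.fourierIntegral_continuous Real.continuous_fourierChar
      (by exact continuous_inner) (hfi (-1) (by norm_num))
  have hψb : ∀ t, ‖ψ t‖ ≤ c / 2 := by
    intro t
    rcases lt_or_ge t 0 with ht | ht
    · rw [hψneg t ht, norm_zero]; positivity
    -- For `t ≥ 0` the line moves to the imaginary axis instead, where `exp(-xt) → 1`, so the bound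
    -- becomes uniform in `t`.
    · have hlim : Tendsto (fun x : ℝ => c * Real.pi * Real.exp (-x * t)) (𝓝[<] 0)
          (𝓝 (c * Real.pi * Real.exp (-0 * t))) :=
        (Continuous.tendsto (by fun_prop) 0).mono_left nhdsWithin_le_nhds
      have : ‖J (-1) t‖ ≤ c * Real.pi * Real.exp (-0 * t) := ge_of_tendsto hlim (by
        filter_upwards [self_mem_nhdsWithin] with x hx
        rw [← hJeq x t hx]
        exact hJ x t hx)
      simp only [neg_zero, zero_mul, Real.exp_zero, mul_one] at this
      simp only [ψ]
      rw [norm_mul, Complex.norm_real, Real.norm_of_nonneg (by positivity)]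
      calc (2 * Real.pi)⁻¹ * ‖J (-1) t‖ ≤ (2 * Real.pi)⁻¹ * (c * Real.pi) := by gcongr
        _ = c / 2 := by field_simp
  refine ⟨ψ, hψc, ⟨c / 2, hψb⟩, fun z hz => ?_⟩
  -- The transform vanishes on the negative axis and decays like `exp(t Re z)` on the positive one.
  -- This integrability is what Fourier inversion needs.
  have hint : Integrable (𝓕 (f z.re)) := by
    have h1 : 𝓕 (f z.re) = indicator (Ici 0) fun t => ψ t * Complex.exp (z.re * t) := by
      ext t
      rw [hψF _ t hz]
      by_cases ht : 0 ≤ t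
      · rw [indicator_of_mem (by exact ht)]
      · rw [indicator_of_notMem (by exact ht), hψneg t (not_le.1 ht), zero_mul]
    rw [h1, integrable_indicator_iff measurableSet_Ici, integrableOn_Ici_iff_integrableOn_Ioi]
    refine Integrable.mono' ((integrableOn_exp_mul_Ioi hz 0).const_mul (c / 2))
      (by fun_prop) (Eventually.of_forall fun t => ?_)
    rw [norm_mul, cexp_mul_norm, Complex.ofReal_re]
    gcongr
    exact hψb t
  have hinv := (hfi z.re hz).fourierInv_fourier_eq hint
    (hfc z.re hz).continuousAt (v := z.im / (2 * Real.pi))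
  have hz' : f z.re (z.im / (2 * Real.pi)) = k z := by
    simp only [f]
    rw [mul_div_cancel₀ _ Real.two_pi_pos.ne', Complex.re_add_im]
  rw [← hz', ← hinv, Real.fourierInv_eq']
  rw [← setIntegral_eq_integral_of_forall_compl_eq_zero (s := Ici 0), integral_Ici_eq_integral_Ioi]
  · refine integral_congr_ae (Eventually.of_forall fun t => ?_)
    simp only [hψF _ t hz, smul_eq_mul]
    rw [mul_left_comm, ← Complex.exp_add]
    congr 2
    have : (Real.pi : ℂ) ≠ 0 := by exact_mod_cast Real.pi_ne_zero
    simp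
    field_simp
    linear_combination (t : ℂ) * Complex.re_add_im z
  · intro t ht
    rw [hψF _ t hz, hψneg t (not_le.1 ht), zero_mul, smul_zero]

/-! ### Horizontal boundary limits -/

/-- A kernel reproducing the derivative of a Laplace integral from its values on a vertical line. -/
def derivKernel (ξ : ℝ) : ℂ :=
  1 / (1 + 2 * Real.pi * ξ * Complex.I) ^ 2 - 1 / (1 - 2 * Real.pi * ξ * Complex.I) ^ 2

theorem derivKernel_eq (ξ : ℝ) :
    derivKernel ξ = -(8 * Real.pi * ξ * Complex.I) / ((1 + (2 * Real.pi * ξ) ^ 2 : ℝ) : ℂ) ^ 2 := by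
  have h : ((1 + (2 * Real.pi * ξ) ^ 2 : ℝ) : ℂ)
      = (1 + 2 * Real.pi * ξ * Complex.I) * (1 - 2 * Real.pi * ξ * Complex.I) := by
    push_cast
    linear_combination ((2 * Real.pi * ξ) ^ 2 : ℂ) * Complex.I_sq
  have h0 : ((1 + (2 * Real.pi * ξ) ^ 2 : ℝ) : ℂ) ≠ 0 := by
    exact_mod_cast (by positivity : (1 + (2 * Real.pi * ξ) ^ 2 : ℝ) ≠ 0)
  rw [h] at h0 ⊢
  have h1 := left_ne_zero_of_mul h0
  have h2 := right_ne_zero_of_mul h0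
  rw [derivKernel]
  field_simp
  ring

theorem norm_derivKernel (ξ : ℝ) :
    ‖derivKernel ξ‖ = 4 * |2 * Real.pi * ξ| / (1 + (2 * Real.pi * ξ) ^ 2) ^ 2 := by
  rw [derivKernel_eq, norm_div, norm_neg, norm_pow, Complex.norm_real,
    Real.norm_of_nonneg (by positivity)]
  congr 1
  rw [norm_mul, Complex.norm_I, mul_one, show (8 * Real.pi * ξ : ℂ) = ((4 * (2 * Real.pi * ξ) : ℝ) : ℂ) by
    push_cast; ring, Complex.norm_real, norm_mul]
  simp

theorem norm_derivKernel_le (ξ : ℝ) :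
    ‖derivKernel ξ‖ ≤ 4 * (1 + (2 * Real.pi * ξ) ^ 2)⁻¹ := by
  rw [norm_derivKernel, ← div_eq_mul_inv, div_le_div_iff₀ (by positivity) (by positivity)]
  have : |2 * Real.pi * ξ| ≤ 1 + (2 * Real.pi * ξ) ^ 2 := by
    rw [abs_le]; constructor <;> nlinarith [sq_nonneg (2 * Real.pi * ξ + 1), sq_nonneg (2 * Real.pi * ξ - 1)]
  nlinarith [sq_nonneg (2 * Real.pi * ξ), abs_nonneg (2 * Real.pi * ξ),
    mul_le_mul_of_nonneg_right this (by positivity : (0 : ℝ) ≤ 1 + (2 * Real.pi * ξ) ^ 2)]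

/-- The kernel decays cubically, so one factor of `ξ` can be spent on a Lipschitz difference
quotient while keeping an integrable bound. -/
theorem abs_mul_norm_derivKernel_le (ξ : ℝ) :
    |2 * Real.pi * ξ| * ‖derivKernel ξ‖ ≤ 4 * (1 + (2 * Real.pi * ξ) ^ 2)⁻¹ := by
  rw [norm_derivKernel, ← div_eq_mul_inv, mul_div_assoc', div_le_div_iff₀ (by positivity) (by positivity)]
  have : |2 * Real.pi * ξ| * (4 * |2 * Real.pi * ξ|) = 4 * (2 * Real.pi * ξ) ^ 2 := by
    rw [mul_left_comm, abs_mul_abs_self, sq]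
  rw [this]
  nlinarith [sq_nonneg (2 * Real.pi * ξ), sq_nonneg ((2 * Real.pi * ξ) ^ 2)]

theorem integrable_derivKernel_bound :
    Integrable fun ξ : ℝ => 4 * (1 + (2 * Real.pi * ξ) ^ 2)⁻¹ :=
  (integrable_inv_one_add_sq.comp_mul_left' (R := 2 * Real.pi) Real.two_pi_pos.ne').const_mul 4

theorem continuous_derivKernel : Continuous derivKernel := by
  have : derivKernel = fun ξ : ℝ =>
      -(8 * Real.pi * ξ * Complex.I) / ((1 + (2 * Real.pi * ξ) ^ 2 : ℝ) : ℂ) ^ 2 :=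
    funext derivKernel_eq
  rw [this]
  refine Continuous.div (by fun_prop) (by fun_prop) fun ξ => pow_ne_zero 2 ?_
  exact_mod_cast (by positivity : (1 + (2 * Real.pi * ξ) ^ 2 : ℝ) ≠ 0)

theorem integrable_derivKernel : Integrable derivKernel :=
  integrable_derivKernel_bound.mono' continuous_derivKernel.aestronglyMeasurable
    (Eventually.of_forall norm_derivKernel_le)

/-! ### Elementary Laplace and Fourier integrals behind the kernel. -/

theorem mul_exp_le {c : ℝ} (hc : c < 0) (t : ℝ) :
    t * Real.exp (c * t) ≤ (-(c / 2))⁻¹ * Real.exp (c / 2 * t) := by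
  -- Half of the decay rate absorbs the factor `t`, by `1 + u ≤ exp u` at `u = -(c/2)t`.
  have h1 := Real.add_one_le_exp (-(c / 2) * t)
  have h2 : t ≤ (-(c / 2))⁻¹ * Real.exp (-(c / 2) * t) := by
    rw [← div_eq_inv_mul, le_div_iff₀ (by linarith)]
    linarith
  calc t * Real.exp (c * t)
      ≤ (-(c / 2))⁻¹ * Real.exp (-(c / 2) * t) * Real.exp (c * t) := by gcongr
    _ = (-(c / 2))⁻¹ * Real.exp (c / 2 * t) := by
        rw [mul_assoc, ← Real.exp_add]; congr 2; ring

theorem norm_mul_cexp_le {a : ℂ} (ha : a.re < 0) {t : ℝ} (ht : 0 ≤ t) :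
    ‖(t : ℂ) * Complex.exp (a * t)‖ ≤ (-(a.re / 2))⁻¹ * Real.exp (a.re / 2 * t) := by
  rw [norm_mul, cexp_mul_norm, Complex.norm_real, Real.norm_of_nonneg ht]
  exact mul_exp_le ha t

theorem integrableOn_mul_cexp {a : ℂ} (ha : a.re < 0) :
    IntegrableOn (fun t : ℝ => (t : ℂ) * Complex.exp (a * t)) (Ioi 0) := by
  have h : a.re / 2 < 0 := by linarith
  refine Integrable.mono' ((integrableOn_exp_mul_Ioi h 0).const_mul (-(a.re / 2))⁻¹)
    (by fun_prop) ?_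
  filter_upwards [ae_restrict_mem measurableSet_Ioi] with t ht
  exact norm_mul_cexp_le ha (le_of_lt ht)

theorem integral_mul_cexp {a : ℂ} (ha : a.re < 0) :
    ∫ t : ℝ in Ioi 0, (t : ℂ) * Complex.exp (a * t) = 1 / a ^ 2 := by
  have ha0 : a ≠ 0 := by rintro rfl; simp at ha
  have hexp : Tendsto (fun t : ℝ => Complex.exp (a * t)) atTop (𝓝 0) := by
    rw [tendsto_zero_iff_norm_tendsto_zero]
    simp only [cexp_mul_norm]
    exact Real.tendsto_exp_atBot.comp (tendsto_id.const_mul_atTop_of_neg ha)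
  have hmul : Tendsto (fun t : ℝ => (t : ℂ) * Complex.exp (a * t)) atTop (𝓝 0) := by
    have h2 : Tendsto (fun t : ℝ => (-(a.re / 2))⁻¹ * Real.exp (a.re / 2 * t)) atTop (𝓝 0) := by
      simpa using (Real.tendsto_exp_atBot.comp
        (tendsto_id.const_mul_atTop_of_neg (show a.re / 2 < 0 by linarith))).const_mul
          (-(a.re / 2))⁻¹
    refine squeeze_zero_norm' ?_ h2
    filter_upwards [eventually_ge_atTop 0] with t ht
    exact norm_mul_cexp_le ha ht
  have h := integral_Ioi_of_hasDerivAt_of_tendsto'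
    (f := fun t : ℝ => a⁻¹ * ((t : ℂ) * Complex.exp (a * t)) - (a ^ 2)⁻¹ * Complex.exp (a * t))
    (f' := fun t : ℝ => (t : ℂ) * Complex.exp (a * t)) (a := 0)
    (m := a⁻¹ * 0 - (a ^ 2)⁻¹ * 0) ?_ (integrableOn_mul_cexp ha)
    ((hmul.const_mul _).sub (hexp.const_mul _))
  · rw [h]; simp
  · intro t _
    have h1 : HasDerivAt (fun t : ℝ => (t : ℂ)) 1 t := Complex.ofRealCLM.hasDerivAt
    have h2 : HasDerivAt (fun t : ℝ => Complex.exp (a * t)) (Complex.exp (a * t) * (a * 1)) t :=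
      (h1.const_mul a).cexp
    convert! ((h1.mul h2).const_mul a⁻¹).sub (h2.const_mul (a ^ 2)⁻¹) using 1
    field_simp
    ring

theorem integrableOn_Iic_zero_comp_neg {f : ℝ → ℂ} (hf : IntegrableOn f (Ioi 0)) :
    IntegrableOn (fun t => f (-t)) (Iic 0) := by
  rw [← integrableOn_Ici_iff_integrableOn_Ioi] at hf
  have := ((Measure.measurePreserving_neg (volume : Measure ℝ)).integrableOn_comp_preimage
    (Homeomorph.neg ℝ).measurableEmbedding (f := f) (s := Ici 0)).2 hf
  simpa [Function.comp_def] using this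

theorem integrableOn_Ioi_mul_exp_neg_abs (b : ℝ) :
    IntegrableOn (fun t : ℝ => Complex.exp (b * t * Complex.I) * (t * Complex.exp (-|t| : ℝ)))
      (Ioi 0) ∧
    ∫ t : ℝ in Ioi 0, Complex.exp (b * t * Complex.I) * (t * Complex.exp (-|t| : ℝ))
      = 1 / (1 - b * Complex.I) ^ 2 := by
  have ha : (-1 + b * Complex.I).re < 0 := by simp
  have h1 : EqOn (fun t : ℝ => (t : ℂ) * Complex.exp ((-1 + b * Complex.I) * t))
      (fun t : ℝ => Complex.exp (b * t * Complex.I) * (t * Complex.exp (-|t| : ℝ))) (Ioi 0) := by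
    intro t ht
    simp only
    rw [abs_of_pos ht, mul_left_comm, ← Complex.exp_add]
    congr 2
    push_cast
    ring
  refine ⟨(integrableOn_mul_cexp ha).congr_fun h1 measurableSet_Ioi, ?_⟩
  rw [← setIntegral_congr_fun measurableSet_Ioi h1, integral_mul_cexp ha]
  congr 1
  ring

/-- Since `t exp(-|t|)` is odd, the negative half-line contributes minus the half-line integral at
frequency `-b`. -/
theorem integrable_mul_exp_neg_abs (b : ℝ) :
    Integrable (fun t : ℝ => Complex.exp (b * t * Complex.I) * (t * Complex.exp (-|t| : ℝ))) ∧
    ∫ t : ℝ, Complex.exp (b * t * Complex.I) * (t * Complex.exp (-|t| : ℝ))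
      = 1 / (1 - b * Complex.I) ^ 2 - 1 / (1 + b * Complex.I) ^ 2 := by
  obtain ⟨h1, h2⟩ := integrableOn_Ioi_mul_exp_neg_abs b
  obtain ⟨h3, h4⟩ := integrableOn_Ioi_mul_exp_neg_abs (-b)
  have h5 := integral_comp_neg_Iic 0
    (fun t : ℝ => Complex.exp ((-b : ℝ) * t * Complex.I) * (t * Complex.exp (-|t| : ℝ)))
  have h6 := (integrableOn_Iic_zero_comp_neg h3).neg
  rw [neg_zero, h4] at h5
  have h7 : (fun t : ℝ => Complex.exp (b * t * Complex.I) * (t * Complex.exp (-|t| : ℝ)))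
      = -fun t : ℝ => Complex.exp ((-b : ℝ) * (-t : ℝ) * Complex.I)
        * ((-t : ℝ) * Complex.exp (-|-t| : ℝ)) := by
    ext t
    simp
  constructor
  · rw [← integrableOn_univ, ← Iic_union_Ioi (a := (0 : ℝ))]
    refine IntegrableOn.union ?_ h1
    rw [h7]
    exact h6
  · rw [← intervalIntegral.integral_Iic_add_Ioi (b := 0) (by rw [h7]; exact h6) h1, h2]
    nth_rewrite 1 [h7]
    rw [integral_neg', h5]
    push_cast
    ring

/-- This is the origin of the kernel. Its integrability allows Fourier inversion, which recovers `t
exp(-t)` for `t ≥ 0`. -/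
theorem fourier_mul_exp_neg_abs (ξ : ℝ) :
    𝓕 (fun t : ℝ => (t : ℂ) * Complex.exp (-|t| : ℝ)) ξ = derivKernel ξ := by
  rw [Real.fourier_real_eq_integral_exp_smul]
  have h := (integrable_mul_exp_neg_abs (-(2 * Real.pi * ξ))).2
  rw [derivKernel]
  push_cast at h ⊢
  rw [neg_mul, sub_neg_eq_add, ← sub_eq_add_neg] at h
  rw [← h]
  refine integral_congr_ae (Eventually.of_forall fun t => ?_)
  simp only [smul_eq_mul]
  congr 2
  ring

/-- The Fourier transform of the kernel. -/
theorem integral_derivKernel_mul_cexp {t : ℝ} (ht : 0 ≤ t) :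
    ∫ ξ : ℝ, derivKernel ξ * Complex.exp (2 * Real.pi * ξ * t * Complex.I) = t * Complex.exp (-t) := by
  have h := Continuous.fourierInv_fourier_eq (f := fun t : ℝ => (t : ℂ) * Complex.exp (-|t| : ℝ))
    (by fun_prop) ?_ ?_
  · have h1 := congrFun h t
    rw [Real.fourierInv_eq'] at h1
    simp only [fourier_mul_exp_neg_abs, abs_of_nonneg ht, smul_eq_mul] at h1
    push_cast at h1
    rw [← h1]
    refine integral_congr_ae (Eventually.of_forall fun ξ => ?_)
    simp only
    rw [mul_comm]
    congr 2
    simp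
    ring
  · simpa using (integrable_mul_exp_neg_abs 0).1
  · rw [funext fourier_mul_exp_neg_abs]
    exact integrable_derivKernel

theorem integral_derivKernel : ∫ ξ : ℝ, derivKernel ξ = 0 := by
  simpa using integral_derivKernel_mul_cexp le_rfl

/-! ### Laplace integrals of bounded densities and their derivatives. -/

theorem integrableOn_mul_cexp_of_bounded {χ : ℝ → ℂ} (hχ : Continuous χ) {C : ℝ}
    (hC : ∀ t, ‖χ t‖ ≤ C) {z : ℂ} (hz : z.re < 0) :
    IntegrableOn (fun t : ℝ => χ t * Complex.exp (z * t)) (Ioi 0) := by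
  refine Integrable.mono' ((integrableOn_exp_mul_Ioi hz 0).const_mul C)
    (by fun_prop) (Eventually.of_forall fun t => ?_)
  rw [norm_mul, cexp_mul_norm]
  gcongr
  exact hC t

theorem hasDerivAt_laplace {χ : ℝ → ℂ} (hχ : Continuous χ) {C : ℝ} (hC : ∀ t, ‖χ t‖ ≤ C)
    {z : ℂ} (hz : z.re < 0) :
    HasDerivAt (fun z : ℂ => ∫ t in Ioi 0, χ t * Complex.exp (z * t))
      (∫ t : ℝ in Ioi 0, χ t * (t * Complex.exp (z * t))) z := by
  have hC0 : 0 ≤ C := (norm_nonneg _).trans (hC 0)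
  have hh : z.re / 2 < 0 := by linarith
  -- On a ball of radius `-Re z / 2` the exponentials decay at least at the rate `Re z / 2`, which
  -- gives one integrable bound for all the derivatives.
  have hball : ∀ w ∈ Metric.ball z (-(z.re / 2)), w.re < z.re / 2 := by
    intro w hw
    have h1 := (Complex.abs_re_le_norm (w - z)).trans_lt (mem_ball_iff_norm.1 hw)
    rw [Complex.sub_re] at h1
    linarith [(abs_lt.1 h1).2]
  refine (hasDerivAt_integral_of_dominated_loc_of_deriv_le
    (F := fun (z : ℂ) (t : ℝ) => χ t * Complex.exp (z * t))
    (F' := fun (z : ℂ) (t : ℝ) => χ t * (t * Complex.exp (z * t)))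
    (bound := fun t : ℝ => C * ‖(t : ℂ) * Complex.exp ((z.re / 2 : ℝ) * t)‖)
    (Metric.ball_mem_nhds z (by linarith : 0 < -(z.re / 2)))
    (Eventually.of_forall fun w => by fun_prop)
    (integrableOn_mul_cexp_of_bounded hχ hC hz) (by fun_prop) ?_ ?_ ?_).2
  · filter_upwards [ae_restrict_mem measurableSet_Ioi] with t ht w hw
    rw [norm_mul]
    refine mul_le_mul (hC t) ?_ (norm_nonneg _) hC0
    rw [norm_mul, norm_mul, cexp_mul_norm, cexp_mul_norm, Complex.ofReal_re]
    refine mul_le_mul_of_nonneg_left (Real.exp_le_exp.2 ?_) (norm_nonneg _)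
    exact mul_le_mul_of_nonneg_right (hball w hw).le (le_of_lt ht)
  · exact ((integrableOn_mul_cexp (a := (z.re / 2 : ℝ))
      (by rwa [Complex.ofReal_re])).norm).const_mul C
  · refine Eventually.of_forall fun t w _ => ?_
    have := (((hasDerivAt_id w).mul_const (t : ℂ)).cexp).const_mul (χ t)
    convert! this using 1
    simp only [id_eq]
    ring

/-- A Laplace integral on a vertical line reproduces its derivative to the left of the line. -/
theorem integral_derivKernel_mul_laplace {χ : ℝ → ℂ} (hχ : Continuous χ) {C : ℝ}
    (hC : ∀ t, ‖χ t‖ ≤ C) {z : ℂ} (hz : z.re < 0) {y : ℝ} (hy : 0 < y) :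
    ∫ ξ : ℝ, derivKernel ξ * ∫ t in Ioi 0, χ t *
        Complex.exp ((z + 2 * Real.pi * y * ξ * Complex.I) * t)
      = y * ∫ t : ℝ in Ioi 0, χ t * (t * Complex.exp ((z - y) * t)) := by
  have hsplit : ∀ ξ t : ℝ, derivKernel ξ *
      (χ t * Complex.exp ((z + 2 * Real.pi * y * ξ * Complex.I) * t))
      = derivKernel ξ * (χ t * Complex.exp (z * t)) *
        Complex.exp (2 * Real.pi * ξ * (y * t : ℝ) * Complex.I) := by
    intro ξ t
    have : (z + 2 * Real.pi * y * ξ * Complex.I) * t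
        = z * t + 2 * Real.pi * ξ * (y * t : ℝ) * Complex.I := by
      push_cast
      ring
    rw [this, Complex.exp_add]
    ring
  simp_rw [← integral_const_mul, hsplit]
  -- After Fubini the inner integral is the inverse transform of the kernel at `yt`, namely `yt
  -- exp(-yt)`. This moves the abscissa from `z` to `z - y` and supplies the factor `t` of the
  -- derivative.
  rw [integral_integral_swap]
  · refine setIntegral_congr_fun measurableSet_Ioi fun t ht => ?_
    have ht' : (0 : ℝ) ≤ y * t := mul_nonneg hy.le (le_of_lt ht)
    have : ∀ ξ : ℝ, derivKernel ξ * (χ t * Complex.exp (z * t)) *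
        Complex.exp (2 * Real.pi * ξ * (y * t : ℝ) * Complex.I)
        = (χ t * Complex.exp (z * t)) * (derivKernel ξ *
        Complex.exp (2 * Real.pi * ξ * (y * t : ℝ) * Complex.I)) := fun ξ => by ring
    simp_rw [this]
    rw [integral_const_mul, integral_derivKernel_mul_cexp ht']
    rw [sub_mul, sub_eq_add_neg, Complex.exp_add]
    push_cast
    ring
  · refine Integrable.mul_bdd (c := 1) (integrable_derivKernel.mul_prod
      (integrableOn_mul_cexp_of_bounded hχ hC hz)) (by fun_prop) ?_
    refine Eventually.of_forall fun p => le_of_eq ?_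
    rw [Complex.norm_exp]
    simp

/-- The reproducing formula writes `W'` at distance `y` from the axis as an average of difference
quotients, at scale `y`, of the boundary values of `W`. These boundary values are Lipschitz, hence
differentiable almost everywhere, and the averages converge at each point of differentiability. -/
theorem ae_exists_tendsto_deriv {W : ℂ → ℂ} (hW : DifferentiableOn ℂ W {z : ℂ | z.re < 0})
    {c : ℝ} (hc : ∀ z : ℂ, z.re < 0 → ‖W z‖ ≤ c * (1 + z.im ^ 2)⁻¹) {K : ℝ≥0}
    (hK : LipschitzOnWith K W {z : ℂ | z.re < 0}) :
    ∀ᵐ ω : ℝ, ∃ l : ℂ, Tendsto (fun x : ℝ => deriv W (x + ω * Complex.I)) (𝓝[<] 0) (𝓝 l) := by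
  obtain ⟨χ, hχ, ⟨C, hC⟩, hWχ⟩ := exists_laplace_density hW hc
  have hc0 : 0 ≤ c := by
    have := (norm_nonneg _).trans (hc (-1) (by simp))
    simpa using this
  -- A Lipschitz extension to the whole plane supplies continuous boundary values; only its values
  -- on the closed left half-plane matter.
  obtain ⟨V, hV, hVW⟩ := hK.extend_finite_dimension
  set L := lipschitzExtensionConstant ℂ * K
  have hderiv : ∀ z : ℂ, z.re < 0 →
      deriv W z = ∫ t : ℝ in Ioi 0, χ t * (t * Complex.exp (z * t)) := fun z hz => by
    refine ((hasDerivAt_laplace hχ hC hz).congr_of_eventuallyEq ?_).deriv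
    filter_upwards [isOpen_leftHalfPlane.mem_nhds hz] with w hw using hWχ w hw
  have hdc : ContinuousOn (deriv W) {z : ℂ | z.re < 0} := (hW.deriv isOpen_leftHalfPlane).continuousOn
  have hform : ∀ (z : ℂ) (y : ℝ), z.re < 0 → 0 < y →
      ∫ ξ : ℝ, derivKernel ξ * V (z + 2 * Real.pi * y * ξ * Complex.I) = y * deriv W (z - y) := by
    intro z y hz hy
    rw [hderiv (z - y) (by simp; linarith), ← integral_derivKernel_mul_laplace hχ hC hz hy]
    refine integral_congr_ae (Eventually.of_forall fun ξ => ?_)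
    have : (z + 2 * Real.pi * y * ξ * Complex.I).re < 0 := by simpa using hz
    simp only
    rw [← hVW this, hWχ _ this]
  -- The reproducing formula passes to the imaginary axis. The point `iω - y` stays inside the
  -- half-plane, and the integrand is dominated because `W` is bounded by `c`.
  have hbdry : ∀ (ω y : ℝ), 0 < y →
      ∫ ξ : ℝ, derivKernel ξ * V ((ω + 2 * Real.pi * y * ξ : ℝ) * Complex.I)
        = y * deriv W (ω * Complex.I - y) := by
    intro ω y hy
    have h1 : Tendsto (fun x : ℝ => (y : ℂ) * deriv W (x + ω * Complex.I - y)) (𝓝[<] 0)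
        (𝓝 (y * deriv W ((0 : ℝ) + ω * Complex.I - y))) := by
      refine Tendsto.const_mul _ ?_
      have hmem : ((0 : ℝ) + ω * Complex.I - y : ℂ).re < 0 := by simpa using hy
      exact ((hdc.continuousAt (isOpen_leftHalfPlane.mem_nhds hmem)).tendsto.comp
        ((Continuous.tendsto (by fun_prop) (0 : ℝ)))).mono_left nhdsWithin_le_nhds
    have h2 : Tendsto (fun x : ℝ => ∫ ξ : ℝ, derivKernel ξ *
        V (x + ω * Complex.I + 2 * Real.pi * y * ξ * Complex.I)) (𝓝[<] 0)
        (𝓝 (∫ ξ : ℝ, derivKernel ξ *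
          V ((0 : ℝ) + ω * Complex.I + 2 * Real.pi * y * ξ * Complex.I))) := by
      refine tendsto_integral_filter_of_dominated_convergence (fun ξ => ‖derivKernel ξ‖ * c)
        (Eventually.of_forall fun x => ?_) ?_ (integrable_derivKernel.norm.mul_const c)
        (Eventually.of_forall fun ξ => ?_)
      · exact (continuous_derivKernel.mul
          (hV.continuous.comp (by fun_prop))).aestronglyMeasurable
      · filter_upwards [self_mem_nhdsWithin] with x hx
        refine Eventually.of_forall fun ξ => ?_
        have : (x + ω * Complex.I + 2 * Real.pi * y * ξ * Complex.I : ℂ).re < 0 := by simpa using hx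
        rw [norm_mul, ← hVW this]
        refine mul_le_mul_of_nonneg_left ((hc _ this).trans ?_) (norm_nonneg _)
        refine mul_le_of_le_one_right hc0 (inv_le_one_of_one_le₀ ?_)
        nlinarith [sq_nonneg (x + ω * Complex.I + 2 * Real.pi * y * ξ * Complex.I : ℂ).im]
      · refine Tendsto.const_mul _ ?_
        exact ((hV.continuous.comp (by fun_prop : Continuous fun x : ℝ =>
          (x + ω * Complex.I + 2 * Real.pi * y * ξ * Complex.I : ℂ))).tendsto 0).mono_left
            nhdsWithin_le_nhds
    have h3 := tendsto_nhds_unique (h2.congr' ?_) h1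
    · simp only [Complex.ofReal_zero, zero_add] at h3
      rw [← h3]
      refine integral_congr_ae (Eventually.of_forall fun ξ => ?_)
      simp only
      congr 2
      push_cast
      ring
    · filter_upwards [self_mem_nhdsWithin] with x hx
      exact hform _ y (by simpa using hx) hy
  let γ : ℝ → ℂ := fun s => V (s * Complex.I)
  have hγ : LipschitzWith L γ := by
    refine LipschitzWith.of_dist_le_mul fun s t => (hV.dist_le_mul _ _).trans (le_of_eq ?_)
    rw [dist_eq_norm, ← sub_mul, norm_mul, Complex.norm_I, mul_one, ← Complex.ofReal_sub,
      Complex.norm_real, dist_eq_norm]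
  filter_upwards [hγ.ae_differentiableAt_real] with ω hω
  refine ⟨∫ ξ : ℝ, derivKernel ξ * (2 * Real.pi * ξ * deriv γ ω), ?_⟩
  -- The Lipschitz bound contributes a factor `y` that cancels `y⁻¹`, so the domination is uniform
  -- in `y`.
  have hdiff : ∀ y ξ : ℝ, 0 < y → ‖derivKernel ξ * (y⁻¹ * (γ (ω + 2 * Real.pi * y * ξ) - γ ω))‖
      ≤ L * (4 * (1 + (2 * Real.pi * ξ) ^ 2)⁻¹) := by
    intro y ξ hy
    have h1 : ‖γ (ω + 2 * Real.pi * y * ξ) - γ ω‖ ≤ L * (y * |2 * Real.pi * ξ|) := by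
      have := hγ.dist_le_mul (ω + 2 * Real.pi * y * ξ) ω
      rw [dist_eq_norm, dist_eq_norm, add_sub_cancel_left] at this
      refine this.trans_eq ?_
      rw [show 2 * Real.pi * y * ξ = y * (2 * Real.pi * ξ) by ring, norm_mul,
        Real.norm_of_nonneg hy.le, Real.norm_eq_abs]
    rw [norm_mul, norm_mul, Complex.norm_real, Real.norm_of_nonneg (inv_nonneg.2 hy.le)]
    calc ‖derivKernel ξ‖ * (y⁻¹ * ‖γ (ω + 2 * Real.pi * y * ξ) - γ ω‖)
        ≤ ‖derivKernel ξ‖ * (y⁻¹ * (L * (y * |2 * Real.pi * ξ|))) := by gcongr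
      _ = L * (|2 * Real.pi * ξ| * ‖derivKernel ξ‖) := by field_simp
      _ ≤ _ := mul_le_mul_of_nonneg_left (abs_mul_norm_derivKernel_le ξ) L.2
  have hcont : ∀ y : ℝ, Continuous fun ξ =>
      derivKernel ξ * (y⁻¹ * (γ (ω + 2 * Real.pi * y * ξ) - γ ω)) := fun y => by
    have := hγ.continuous
    have := continuous_derivKernel
    fun_prop
  have hquot : ∀ y : ℝ, 0 < y → deriv W ((-y : ℝ) + ω * Complex.I)
      = ∫ ξ : ℝ, derivKernel ξ * (y⁻¹ * (γ (ω + 2 * Real.pi * y * ξ) - γ ω)) := by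
    intro y hy
    have hy0 : (y : ℂ) ≠ 0 := by exact_mod_cast hy.ne'
    have hi : Integrable fun ξ => derivKernel ξ * (y⁻¹ * (γ (ω + 2 * Real.pi * y * ξ) - γ ω)) :=
      (integrable_derivKernel_bound.const_mul (L : ℝ)).mono' (hcont y).aestronglyMeasurable
        (Eventually.of_forall fun ξ => hdiff y ξ hy)
    have h1 := hbdry ω y hy
    -- The kernel has integral zero, so the value of `γ` at `ω` may be subtracted without changing
    -- the integral.
    have h2 : ∀ ξ : ℝ, derivKernel ξ * V ((ω + 2 * Real.pi * y * ξ : ℝ) * Complex.I)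
        = y * (derivKernel ξ * (y⁻¹ * (γ (ω + 2 * Real.pi * y * ξ) - γ ω)))
          + derivKernel ξ * γ ω := by
      intro ξ
      simp only [γ]
      rw [Complex.ofReal_inv]
      field_simp
      ring
    simp_rw [h2] at h1
    rw [integral_add (hi.const_mul _) (integrable_derivKernel.mul_const _), integral_const_mul,
      integral_mul_const, integral_derivKernel, zero_mul, add_zero] at h1
    rw [mul_left_cancel₀ hy0 h1]
    congr 1
    push_cast
    ring
  have hlim : Tendsto (fun y : ℝ => ∫ ξ : ℝ, derivKernel ξ *
      (y⁻¹ * (γ (ω + 2 * Real.pi * y * ξ) - γ ω))) (𝓝[>] 0)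
      (𝓝 (∫ ξ : ℝ, derivKernel ξ * (2 * Real.pi * ξ * deriv γ ω))) := by
    refine tendsto_integral_filter_of_dominated_convergence
      (fun ξ => L * (4 * (1 + (2 * Real.pi * ξ) ^ 2)⁻¹))
      (Eventually.of_forall fun y => (hcont y).aestronglyMeasurable) ?_
      (integrable_derivKernel_bound.const_mul (L : ℝ)) (Eventually.of_forall fun ξ => ?_)
    · filter_upwards [self_mem_nhdsWithin] with y hy
      exact Eventually.of_forall fun ξ => hdiff y ξ hy
    · refine Tendsto.const_mul _ ?_
      have h1 : HasDerivAt (fun y : ℝ => γ (ω + 2 * Real.pi * y * ξ))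
          ((2 * Real.pi * ξ) • deriv γ ω) 0 := by
        have h2 : HasDerivAt (fun y : ℝ => ω + 2 * Real.pi * y * ξ) (2 * Real.pi * ξ) 0 := by
          have := (((hasDerivAt_id (0 : ℝ)).const_mul (2 * Real.pi)).mul_const ξ).const_add ω
          simpa using this
        have h3 : HasDerivAt γ (deriv γ ω) (ω + 2 * Real.pi * 0 * ξ) := by
          simpa using hω.hasDerivAt
        exact h3.scomp (0 : ℝ) h2
      have h3 := h1.tendsto_slope_zero_right
      refine (h3.congr fun y => ?_).trans (le_of_eq ?_)
      · simp
      · simp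
  have hneg : Tendsto (fun x : ℝ => -x) (𝓝[<] 0) (𝓝[>] 0) := by
    simpa using tendsto_neg_nhdsLT (a := (0 : ℝ))
  refine (hlim.comp hneg).congr' ?_
  filter_upwards [self_mem_nhdsWithin] with x hx
  have := hquot (-x) (by simpa using hx)
  simp only [Function.comp_apply]
  rw [← this, neg_neg]

/-! ### Primitives and Fatou's theorem. -/

theorem one_sub_ne_zero {z : ℂ} (hz : z.re < 0) : 1 - z ≠ 0 := by
  intro h
  have := congrArg Complex.re h
  simp at this
  linarith

theorem normSq_one_sub {z : ℂ} (hz : z.re < 0) : 1 + z.im ^ 2 ≤ ‖1 - z‖ ^ 2 := by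
  rw [← Complex.normSq_eq_norm_sq, Complex.normSq_apply]
  simp
  nlinarith

theorem one_le_norm_one_sub {z : ℂ} (hz : z.re < 0) : 1 ≤ ‖1 - z‖ := by
  have := normSq_one_sub hz
  nlinarith [sq_nonneg z.im, norm_nonneg (1 - z)]

/-- Holomorphic functions on the left half-plane have primitives. -/
theorem exists_primitive {g : ℂ → ℂ} (hg : DifferentiableOn ℂ g {z : ℂ | z.re < 0}) :
    ∃ G : ℂ → ℂ, ∀ z : ℂ, z.re < 0 → HasDerivAt G (g z) z := by
  have hne : ∀ w ∈ Metric.ball (0 : ℂ) 1, w + 1 ≠ 0 := by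
    intro w hw h
    rw [mem_ball_zero_iff, eq_neg_of_add_eq_zero_left h] at hw
    simp at hw
  have hφ : ∀ w ∈ Metric.ball (0 : ℂ) 1, ((w - 1) / (w + 1)).re < 0 := by
    intro w hw
    have h1 : ‖w‖ ^ 2 < 1 := by
      have := mem_ball_zero_iff.1 hw
      nlinarith [norm_nonneg w]
    have h2 : 0 < Complex.normSq (w + 1) := Complex.normSq_pos.2 (hne w hw)
    rw [← Complex.normSq_eq_norm_sq, Complex.normSq_apply] at h1
    rw [Complex.div_re, ← add_div, div_neg_iff]
    refine Or.inr ⟨?_, h2⟩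
    simp
    nlinarith
  -- The Cayley transform `z = (w - 1)/(w + 1)` carries the problem to the unit disc, where
  -- holomorphic functions have primitives. The factor `2/(w + 1)²` is `dz/dw`.
  have hd : DifferentiableOn ℂ (fun w => g ((w - 1) / (w + 1)) * (2 / (w + 1) ^ 2))
      (Metric.ball 0 1) := by
    refine DifferentiableOn.mul (hg.comp ?_ hφ) ?_
    · exact DifferentiableOn.div (by fun_prop) (by fun_prop) hne
    · exact DifferentiableOn.div (by fun_prop) (by fun_prop) fun w hw => pow_ne_zero 2 (hne w hw)
  obtain ⟨H, hH⟩ := hd.isExactOn_ball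
  refine ⟨fun z => H ((1 + z) / (1 - z)), fun z hz => ?_⟩
  have hz0 := one_sub_ne_zero hz
  have hmem : (1 + z) / (1 - z) ∈ Metric.ball (0 : ℂ) 1 := by
    rw [mem_ball_zero_iff, norm_div, div_lt_one (norm_pos_iff.2 hz0)]
    refine lt_of_pow_lt_pow_left₀ 2 (norm_nonneg _) ?_
    rw [← Complex.normSq_eq_norm_sq, ← Complex.normSq_eq_norm_sq, Complex.normSq_apply,
      Complex.normSq_apply]
    simp
    nlinarith
  have h1 : HasDerivAt (fun z : ℂ => (1 + z) / (1 - z)) (2 / (1 - z) ^ 2) z := by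
    have := ((hasDerivAt_id z).const_add 1).div ((hasDerivAt_id z).const_sub 1) hz0
    convert! this using 1
    simp only [id_eq]
    congr 1
    ring
  have h2 := (hH _ hmem).comp z h1
  convert! h2 using 1
  have h3 : (1 + z) / (1 - z) + 1 = 2 / (1 - z) := by field_simp; ring
  have h4 : ((1 + z) / (1 - z) - 1) / ((1 + z) / (1 - z) + 1) = z := by
    rw [h3]; field_simp; ring
  beta_reduce
  rw [h4, h3]
  field_simp

theorem extZero_of_neg (g : LeftHalfPlane → ℂ) {z : ℂ} (hz : z.re < 0) :
    extZero g z = g ⟨z, hz⟩ := dif_pos hz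

theorem norm_extZero_le {g : LeftHalfPlane → ℂ} {c : ℝ} (hc : ∀ z, ‖g z‖ ≤ c) {z : ℂ}
    (hz : z.re < 0) : ‖extZero g z‖ ≤ c := by
  rw [extZero_of_neg g hz]
  exact hc _

/-- Fatou's theorem: bounded holomorphic functions have boundary limits almost everywhere. -/
theorem ae_exists_tendsto_extZero (g : HInf) :
    ∀ᵐ ω : ℝ, ∃ l : ℂ,
      Tendsto (fun x : ℝ => extZero g.1 (x + ω * Complex.I)) (𝓝[<] 0) (𝓝 l) := by
  obtain ⟨hg, C, hC⟩ := g.2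
  have hC' : ∀ z : ℂ, z.re < 0 → ‖extZero g.1 z‖ ≤ C := fun z hz => norm_extZero_le hC hz
  have hC0 : 0 ≤ C := (norm_nonneg _).trans (hC' (-1) (by simp))
  obtain ⟨G, hG⟩ := exists_primitive hg
  have hGl : LipschitzOnWith C.toNNReal G {z : ℂ | z.re < 0} :=
    convex_leftHalfPlane.lipschitzOnWith_of_nnnorm_deriv_le
      (fun z hz => (hG z hz).differentiableAt) fun z hz => by
        rw [(hG z hz).deriv, ← NNReal.coe_le_coe, coe_nnnorm, Real.coe_toNNReal C hC0]
        exact hC' z hz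
  set D := ‖G (-1)‖ + C with hD
  have hGD : ∀ z : ℂ, z.re < 0 → ‖G z‖ ≤ D * ‖1 - z‖ := by
    intro z hz
    have h1 := hGl.dist_le_mul z hz (-1) (by simp)
    rw [dist_eq_norm, dist_eq_norm, Real.coe_toNNReal C hC0, sub_neg_eq_add] at h1
    have h2 : ‖z + 1‖ ≤ ‖1 - z‖ := by
      refine (pow_le_pow_iff_left₀ (norm_nonneg _) (norm_nonneg _) two_ne_zero).1 ?_
      rw [← Complex.normSq_eq_norm_sq, ← Complex.normSq_eq_norm_sq, Complex.normSq_apply,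
        Complex.normSq_apply]
      simp
      nlinarith
    have h3 := one_le_norm_one_sub hz
    calc ‖G z‖ ≤ ‖G (-1)‖ + ‖G z - G (-1)‖ := by
          simpa using norm_add_le (G (-1)) (G z - G (-1))
      _ ≤ ‖G (-1)‖ * ‖1 - z‖ + C * ‖1 - z‖ := by
          refine add_le_add (le_mul_of_one_le_right (norm_nonneg _) h3) (h1.trans ?_)
          gcongr
      _ = D * ‖1 - z‖ := by rw [hD]; ring
  -- The primitive `G` grows at most linearly. One power of `(1 - z)⁻¹` absorbs this growth and two
  -- more give quadratic decay, while `W'` stays bounded.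
  let W : ℂ → ℂ := fun z => G z * ((1 - z)⁻¹) ^ 3
  have hWd : ∀ z : ℂ, z.re < 0 → HasDerivAt W
      (extZero g.1 z * ((1 - z)⁻¹) ^ 3 + 3 * G z * ((1 - z)⁻¹) ^ 4) z := by
    intro z hz
    have hz0 := one_sub_ne_zero hz
    have h1 := ((((hasDerivAt_id z).const_sub 1).inv hz0).pow 3)
    convert! (hG z hz).mul h1 using 1
    simp
    field_simp
  have hinv : ∀ z : ℂ, z.re < 0 → ‖(1 - z)⁻¹‖ ≤ 1 := fun z hz => by
    rw [norm_inv]; exact inv_le_one_of_one_le₀ (one_le_norm_one_sub hz)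
  have hD0 : 0 ≤ D := by positivity
  have hGD' : ∀ z : ℂ, z.re < 0 → ‖G z‖ * ‖(1 - z)⁻¹‖ ≤ D := fun z hz => by
    rw [norm_inv, ← div_eq_mul_inv, div_le_iff₀ (norm_pos_iff.2 (one_sub_ne_zero hz))]
    exact hGD z hz
  have hWl : LipschitzOnWith (C + 3 * D).toNNReal W {z : ℂ | z.re < 0} :=
    convex_leftHalfPlane.lipschitzOnWith_of_nnnorm_deriv_le
      (fun z hz => (hWd z hz).differentiableAt) fun z hz => by
        rw [(hWd z hz).deriv, ← NNReal.coe_le_coe, coe_nnnorm, Real.coe_toNNReal _ (by positivity)]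
        refine (norm_add_le _ _).trans (add_le_add ?_ ?_)
        · rw [norm_mul, norm_pow]
          exact (mul_le_of_le_one_right (norm_nonneg _)
            (pow_le_one₀ (norm_nonneg _) (hinv z hz))).trans (hC' z hz)
        · rw [show 3 * G z * ((1 - z)⁻¹) ^ 4 = 3 * ((G z * (1 - z)⁻¹) * ((1 - z)⁻¹) ^ 3) by ring,
            norm_mul, norm_mul, norm_pow, norm_mul, RCLike.norm_ofNat]
          gcongr
          exact (mul_le_of_le_one_right (by positivity)
            (pow_le_one₀ (norm_nonneg _) (hinv z hz))).trans (hGD' z hz)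
  have hWb : ∀ z : ℂ, z.re < 0 → ‖W z‖ ≤ D * (1 + z.im ^ 2)⁻¹ := by
    intro z hz
    rw [show W z = (G z * (1 - z)⁻¹) * ((1 - z)⁻¹) ^ 2 by simp only [W]; ring, norm_mul, norm_mul,
      norm_pow]
    refine mul_le_mul (hGD' z hz) ?_ (by positivity) hD0
    rw [norm_inv, inv_pow]
    exact inv_anti₀ (by positivity) (normSq_one_sub hz)
  -- The Lipschitz primitive extends continuously, so it has a boundary limit at every point.
  obtain ⟨V, hV, hVG⟩ := hGl.extend_finite_dimension
  filter_upwards [ae_exists_tendsto_deriv (fun z hz =>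
    (hWd z hz).differentiableAt.differentiableWithinAt) hWb hWl] with ω ⟨l, hl⟩
  have hline : Continuous fun x : ℝ => (x + ω * Complex.I : ℂ) := by fun_prop
  have hne : (1 - ((0 : ℝ) + ω * Complex.I) : ℂ) ≠ 0 := by
    intro h
    simpa using congrArg Complex.re h
  have h1 : Tendsto (fun x : ℝ => 1 - (x + ω * Complex.I : ℂ)) (𝓝[<] 0)
      (𝓝 (1 - ((0 : ℝ) + ω * Complex.I))) :=
    ((continuous_const.sub hline).tendsto 0).mono_left nhdsWithin_le_nhds
  have h2 : Tendsto (fun x : ℝ => V (x + ω * Complex.I)) (𝓝[<] 0)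
      (𝓝 (V ((0 : ℝ) + ω * Complex.I))) :=
    ((hV.continuous.comp hline).tendsto 0).mono_left nhdsWithin_le_nhds
  -- Solving the formula for `W'` gives `g = (1 - z)³ W' - 3G/(1 - z)`, and every term on the right
  -- has a limit.
  refine ⟨_, (((h1.pow 3).mul hl).sub ((h2.const_mul 3).mul (h1.inv₀ hne))).congr' ?_⟩
  filter_upwards [self_mem_nhdsWithin] with x hx
  have hx' : (x + ω * Complex.I : ℂ).re < 0 := by simpa using hx
  have h0 := one_sub_ne_zero hx'
  rw [(hWd _ hx').deriv, ← hVG hx']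
  field_simp
  ring

/-! ### Boundary functions of products, sums, constants and exponentials. -/

theorem boundaryFun_eq_of_tendsto {g : LeftHalfPlane → ℂ} {ω : ℝ} {l : ℂ}
    (h : Tendsto (fun x : ℝ => extZero g (x + ω * Complex.I)) (𝓝[<] 0) (𝓝 l)) :
    boundaryFun g ω = l := by
  rw [boundaryFun, if_pos ⟨l, h⟩]
  exact h.limUnder_eq

theorem ae_comp_two_pi_mul {p : ℝ → Prop} (h : ∀ᵐ ω : ℝ, p ω) : ∀ᵐ ξ : ℝ, p (2 * Real.pi * ξ) := by
  have hq : Measure.QuasiMeasurePreserving (fun ξ : ℝ => 2 * Real.pi * ξ) volume volume := by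
    refine ⟨measurable_const_mul _, ?_⟩
    rw [Real.map_volume_mul_left Real.two_pi_pos.ne']
    exact Measure.smul_absolutelyContinuous
  exact hq.ae h

/-- The boundary function, with the imaginary axis parametrized by `ξ ↦ 2 π i ξ`. -/
theorem ae_tendsto_boundaryFun (g : HInf) :
    ∀ᵐ ξ : ℝ, Tendsto (fun x : ℝ => extZero g.1 (x + (2 * Real.pi * ξ : ℝ) * Complex.I)) (𝓝[<] 0)
      (𝓝 (boundaryFun g.1 (2 * Real.pi * ξ))) := by
  filter_upwards [ae_comp_two_pi_mul (ae_exists_tendsto_extZero g)] with ξ ⟨l, hl⟩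
  rwa [boundaryFun_eq_of_tendsto hl]

theorem ae_boundaryFun_mul (f g : HInf) : ∀ᵐ ξ : ℝ, boundaryFun (f * g).1 (2 * Real.pi * ξ)
    = boundaryFun f.1 (2 * Real.pi * ξ) * boundaryFun g.1 (2 * Real.pi * ξ) := by
  filter_upwards [ae_tendsto_boundaryFun f, ae_tendsto_boundaryFun g] with ξ hf hg
  refine boundaryFun_eq_of_tendsto ((hf.mul hg).congr' ?_)
  filter_upwards [self_mem_nhdsWithin] with x hx
  have hx' : (x + (2 * Real.pi * ξ : ℝ) * Complex.I : ℂ).re < 0 := by simpa using hx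
  simp only [extZero_of_neg _ hx']
  rfl

theorem ae_boundaryFun_add (f g : HInf) : ∀ᵐ ξ : ℝ, boundaryFun (f + g).1 (2 * Real.pi * ξ)
    = boundaryFun f.1 (2 * Real.pi * ξ) + boundaryFun g.1 (2 * Real.pi * ξ) := by
  filter_upwards [ae_tendsto_boundaryFun f, ae_tendsto_boundaryFun g] with ξ hf hg
  refine boundaryFun_eq_of_tendsto ((hf.add hg).congr' ?_)
  filter_upwards [self_mem_nhdsWithin] with x hx
  have hx' : (x + (2 * Real.pi * ξ : ℝ) * Complex.I : ℂ).re < 0 := by simpa using hx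
  simp only [extZero_of_neg _ hx']
  rfl

theorem boundaryFun_algebraMap (c : ℂ) (ω : ℝ) : boundaryFun (algebraMap ℂ HInf c).1 ω = c := by
  refine boundaryFun_eq_of_tendsto (tendsto_const_nhds.congr' ?_)
  filter_upwards [self_mem_nhdsWithin] with x hx
  have hx' : (x + ω * Complex.I : ℂ).re < 0 := by simpa using hx
  rw [extZero_of_neg _ hx']
  rfl

theorem boundaryFun_expSymbol (t : ℝ≥0) (ω : ℝ) :
    boundaryFun (expSymbol t).1 ω = Complex.exp ((t : ℝ) * (ω * Complex.I)) := by
  have h : Tendsto (fun x : ℝ => Complex.exp ((t : ℝ) * (x + ω * Complex.I))) (𝓝[<] 0)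
      (𝓝 (Complex.exp ((t : ℝ) * ((0 : ℝ) + ω * Complex.I)))) :=
    (Continuous.tendsto (by fun_prop) 0).mono_left nhdsWithin_le_nhds
  rw [Complex.ofReal_zero, zero_add] at h
  refine boundaryFun_eq_of_tendsto (h.congr' ?_)
  filter_upwards [self_mem_nhdsWithin] with x hx
  have hx' : (x + ω * Complex.I : ℂ).re < 0 := by simpa using hx
  rw [extZero_of_neg _ hx']
  rfl

/-! ### Translations and multiplication operators on `L²` -/

/-- The translation `u ↦ u (· + t)` on `L²(ℝ)`. -/
def shift (t : ℝ) : Lp ℂ 2 (volume : Measure ℝ) →ₗᵢ[ℂ] Lp ℂ 2 (volume : Measure ℝ) :=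
  Lp.compMeasurePreservingₗᵢ ℂ (fun s => s + t) (measurePreserving_add_right volume t)

theorem coeFn_shift (t : ℝ) (u : Lp ℂ 2 (volume : Measure ℝ)) :
    shift t u =ᵐ[volume] fun s => u (s + t) :=
  Lp.coeFn_compMeasurePreserving u (measurePreserving_add_right volume t)

/-- The adjoint of a translation is the opposite translation. For `t ≥ 0` this moves a left shift
onto the other argument as a right shift, which preserves `L²(0,∞)`. -/
theorem inner_shift (t : ℝ) (v u : Lp ℂ 2 (volume : Measure ℝ)) :
    inner ℂ v (shift t u) = inner ℂ (shift (-t) v) u := by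
  rw [← (shift t).inner_map_map (shift (-t) v) u]
  congr 1
  refine Lp.ext ?_
  have h := (measurePreserving_add_right (volume : Measure ℝ) t).quasiMeasurePreserving.ae
    (coeFn_shift (-t) v)
  filter_upwards [coeFn_shift t (shift (-t) v), h] with s h1 h2
  rw [h1, h2, add_neg_cancel_right]

theorem shift_neg_mem {v : Lp ℂ 2 (volume : Measure ℝ)} (hv : v ∈ L2pos) {t : ℝ} (ht : 0 ≤ t) :
    shift (-t) v ∈ L2pos := by
  rw [mem_L2pos_iff] at hv ⊢
  have h1 := (ae_restrict_iff' measurableSet_Iic).1 hv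
  have h := (measurePreserving_add_right (volume : Measure ℝ) (-t)).quasiMeasurePreserving.ae h1
  refine (ae_restrict_iff' measurableSet_Iic).2 ?_
  filter_upwards [coeFn_shift (-t) v, h] with s h2 h3 hs
  rw [h2, h3 (by have : s ≤ 0 := hs; simp; linarith)]
  rfl

/-- Multiplication by a bounded function on `L²(ℝ)`. -/
def mulLp (m : Lp ℂ ∞ (volume : Measure ℝ)) :
    Lp ℂ 2 (volume : Measure ℝ) →L[ℂ] Lp ℂ 2 (volume : Measure ℝ) :=
  LinearMap.mkContinuous
    { toFun := fun u => m • u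
      map_add' := fun u v => Lp.add_smul m u v
      map_smul' := fun c u => (Lp.smul_comm c m u).symm } ‖m‖ (Lp.norm_smul_le m)

theorem coeFn_mulLp (m : Lp ℂ ∞ (volume : Measure ℝ)) (u : Lp ℂ 2 (volume : Measure ℝ)) :
    mulLp m u =ᵐ[volume] fun ξ => m ξ * u ξ :=
  Lp.coeFn_lpSMul m u

theorem memLp_modulation (t : ℝ) :
    MemLp (fun ξ : ℝ => Complex.exp (2 * Real.pi * t * ξ * Complex.I)) ∞ volume :=
  memLp_top_of_bound (by fun_prop) 1 (Eventually.of_forall fun ξ => by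
    rw [Complex.norm_exp]
    simp)

/-- Both sides are continuous in `u`, so it suffices to check Schwartz functions, for which the
pointwise modulation rule applies. -/
theorem fourier_shift (t : ℝ) (u : Lp ℂ 2 (volume : Measure ℝ)) :
    Lp.fourierTransformₗᵢ ℝ ℂ (shift t u)
      = mulLp ((memLp_modulation t).toLp _) (Lp.fourierTransformₗᵢ ℝ ℂ u) := by
  refine DenseRange.induction_on
    (p := fun u => Lp.fourierTransformₗᵢ ℝ ℂ (shift t u)
      = mulLp ((memLp_modulation t).toLp _) (Lp.fourierTransformₗᵢ ℝ ℂ u))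
    (SchwartzMap.denseRange_toLpCLM (E := ℝ) (F := ℂ) (p := 2) (μ := volume)
      ENNReal.ofNat_ne_top) u ?_ ?_
  · refine isClosed_eq ?_ ?_
    · exact (LinearIsometryEquiv.continuous _).comp (shift t).continuous
    · exact (mulLp _).continuous.comp (LinearIsometryEquiv.continuous _)
  · intro f
    rw [SchwartzMap.toLpCLM_apply]
    have h1 : shift t (f.toLp 2) = (f.compSubConstCLM ℂ (-t)).toLp 2 := by
      refine Lp.ext ?_
      have h := (measurePreserving_add_right (volume : Measure ℝ) t).quasiMeasurePreserving.ae
        (f.coeFn_toLp 2 volume)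
      filter_upwards [coeFn_shift t (f.toLp 2), h,
        (f.compSubConstCLM ℂ (-t)).coeFn_toLp 2 volume] with s h1 h2 h3
      rw [h1, h2, h3, SchwartzMap.compSubConstCLM_apply, sub_neg_eq_add]
    have h2 : ∀ f : SchwartzMap ℝ ℂ, Lp.fourierTransformₗᵢ ℝ ℂ (f.toLp 2) = (𝓕 f).toLp 2 :=
      fun f => SchwartzMap.toLp_fourier_eq f
    rw [h1, h2, h2]
    refine Lp.ext ?_
    filter_upwards [(𝓕 (f.compSubConstCLM ℂ (-t))).coeFn_toLp 2 volume,
      (𝓕 f).coeFn_toLp 2 volume, coeFn_mulLp ((memLp_modulation t).toLp _) ((𝓕 f).toLp 2),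
      (memLp_modulation t).coeFn_toLp] with ξ h3 h4 h5 h6
    rw [h3, h5, h4, h6, SchwartzMap.fourier_coe, SchwartzMap.fourier_coe]
    have h7 : (⇑(f.compSubConstCLM ℂ (-t)) : ℝ → ℂ) = f ∘ fun v => v + t := by
      ext s
      simp
    rw [h7]
    have h8 := congrFun (VectorFourier.fourierIntegral_comp_add_right Real.fourierChar
      (volume : Measure ℝ) (innerₗ ℝ) f t) ξ
    refine h8.trans ?_
    rw [Circle.smul_def, Real.fourierChar_apply, smul_eq_mul]
    congr 2
    simp
    ring

/-! ### The spectral form of the Toeplitz operator -/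

/-- The cross spectral density of two elements of `L²(ℝ)`. -/
def cross (v u : Lp ℂ 2 (volume : Measure ℝ)) (ξ : ℝ) : ℂ :=
  inner ℂ (Lp.fourierTransformₗᵢ ℝ ℂ v ξ) (Lp.fourierTransformₗᵢ ℝ ℂ u ξ)

theorem integrable_cross (v u : Lp ℂ 2 (volume : Measure ℝ)) : Integrable (cross v u) :=
  L2.integrable_inner _ _

theorem cross_mulLp (v u : Lp ℂ 2 (volume : Measure ℝ)) (m : Lp ℂ ∞ (volume : Measure ℝ)) :
    cross v ((Lp.fourierTransformₗᵢ ℝ ℂ).symm (mulLp m (Lp.fourierTransformₗᵢ ℝ ℂ u)))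
      =ᵐ[volume] fun ξ => m ξ * cross v u ξ := by
  filter_upwards [coeFn_mulLp m (Lp.fourierTransformₗᵢ ℝ ℂ u)] with ξ h
  simp only [cross, LinearIsometryEquiv.apply_symm_apply, h]
  rw [← smul_eq_mul, inner_smul_right]

theorem cross_sub_right (v u w : Lp ℂ 2 (volume : Measure ℝ)) :
    cross v (u - w) =ᵐ[volume] fun ξ => cross v u ξ - cross v w ξ := by
  have h := Lp.coeFn_sub (Lp.fourierTransformₗᵢ ℝ ℂ u) (Lp.fourierTransformₗᵢ ℝ ℂ w)
  filter_upwards [h] with ξ h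
  simp only [cross]
  rw [map_sub, h, Pi.sub_apply, inner_sub_right]

theorem integral_cross (v u : Lp ℂ 2 (volume : Measure ℝ)) :
    ∫ ξ, cross v u ξ = inner ℂ v u := by
  rw [← (Lp.fourierTransformₗᵢ ℝ ℂ).inner_map_map v u, L2.inner_def]
  rfl

theorem inner_mulLp (v u : Lp ℂ 2 (volume : Measure ℝ)) (m : Lp ℂ ∞ (volume : Measure ℝ)) :
    inner ℂ (Lp.fourierTransformₗᵢ ℝ ℂ v) (mulLp m (Lp.fourierTransformₗᵢ ℝ ℂ u))
      = ∫ ξ, m ξ * cross v u ξ := by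
  rw [← integral_congr_ae (cross_mulLp v u m), integral_cross, LinearIsometryEquiv.inner_map_eq_flip]

theorem inner_shift_eq_integral (v u : Lp ℂ 2 (volume : Measure ℝ)) (t : ℝ) :
    inner ℂ v (shift t u)
      = ∫ ξ : ℝ, Complex.exp (2 * Real.pi * t * ξ * Complex.I) * cross v u ξ := by
  rw [← (Lp.fourierTransformₗᵢ ℝ ℂ).inner_map_map, fourier_shift, inner_mulLp]
  refine integral_congr_ae ?_
  filter_upwards [(memLp_modulation t).coeFn_toLp] with ξ h
  rw [h]

theorem inner_mulLp_boundary (g : HInf) (v u : Lp ℂ 2 (volume : Measure ℝ)) :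
    inner ℂ (Lp.fourierTransformₗᵢ ℝ ℂ v) (mulLp (boundary g) (Lp.fourierTransformₗᵢ ℝ ℂ u))
      = ∫ ξ, boundaryFun g.1 (2 * Real.pi * ξ) * cross v u ξ := by
  rw [inner_mulLp]
  refine integral_congr_ae ?_
  filter_upwards [(memLp_boundaryFun g).coeFn_toLp] with ξ h
  rw [boundary, h]

/-- Tested against `v` in `L²(0,∞)`, the orthogonal projection drops out. What remains is a scalar
integral, open to dominated convergence and Fubini. -/
theorem inner_toeplitz (g : HInf) (v f : L2pos) :
    inner ℂ v (toeplitz g f) = ∫ ξ, boundaryFun g.1 (2 * Real.pi * ξ) * cross v f ξ := by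
  rw [toeplitz, ← LinearIsometryEquiv.inner_map_eq_flip,
    Submodule.inner_orthogonalProjectionOnto_eq_of_mem_left]
  exact inner_mulLp_boundary g v f

/-- The Toeplitz operator as a bounded linear operator. -/
def toeplitzL (g : HInf) : L2pos →L[ℂ] L2pos :=
  (laplace.symm.toContinuousLinearEquiv : H2 →L[ℂ] L2pos) ∘L H2.orthogonalProjectionOnto ∘L
    mulLp (boundary g) ∘L H2.subtypeL ∘L (laplace.toContinuousLinearEquiv : L2pos →L[ℂ] H2)

theorem toeplitzL_apply (g : HInf) (f : L2pos) : toeplitzL g f = toeplitz g f := rfl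

theorem norm_boundaryFun_mul_cross_le (g : HInf) {c : ℝ} (hc : ∀ z, ‖g.1 z‖ ≤ c)
    (v u : Lp ℂ 2 (volume : Measure ℝ)) (ξ : ℝ) :
    ‖boundaryFun g.1 (2 * Real.pi * ξ) * cross v u ξ‖ ≤ max c 0 * ‖cross v u ξ‖ := by
  rw [norm_mul]
  gcongr
  exact norm_boundaryFun_le g.1 c hc _

theorem integrable_boundaryFun_mul_cross (g : HInf) (v u : Lp ℂ 2 (volume : Measure ℝ)) :
    Integrable fun ξ => boundaryFun g.1 (2 * Real.pi * ξ) * cross v u ξ := by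
  obtain ⟨c, hc⟩ := g.2.2
  refine ((integrable_cross v u).norm.const_mul (max c 0)).mono' ?_
    (Eventually.of_forall (norm_boundaryFun_mul_cross_le g hc v u))
  exact ((measurable_boundaryFun g).comp (measurable_const_mul _)).aestronglyMeasurable.mul
    (integrable_cross v u).aestronglyMeasurable

/-- A symbol which is the Laplace integral of a bounded density acts as a superposition of
translations. -/
theorem tendsto_integral_inner_shift {g : HInf} {ψ : ℝ → ℂ} (hψ : Continuous ψ) {C : ℝ}
    (hC : ∀ t, 0 < t → ‖ψ t‖ ≤ C)
    (hg : ∀ z : ℂ, z.re < 0 → extZero g.1 z = ∫ t in Ioi 0, ψ t * Complex.exp (z * t))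
    (v u : Lp ℂ 2 (volume : Measure ℝ)) :
    Tendsto (fun x : ℝ => ∫ t in Ioi 0, ψ t * Complex.exp (x * t) * inner ℂ v (shift t u))
      (𝓝[<] 0) (𝓝 (∫ ξ, boundaryFun g.1 (2 * Real.pi * ξ) * cross v u ξ)) := by
  obtain ⟨c, hc⟩ := g.2.2
  -- The boundary values are reached from the lines `Re z = x < 0`. On these the weight `exp(xt)`
  -- makes the merely bounded density integrable, so Fubini applies.
  have h1 : Tendsto (fun x : ℝ => ∫ ξ : ℝ, extZero g.1 (x + (2 * Real.pi * ξ : ℝ) * Complex.I)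
      * cross v u ξ) (𝓝[<] 0) (𝓝 (∫ ξ, boundaryFun g.1 (2 * Real.pi * ξ) * cross v u ξ)) := by
    refine tendsto_integral_filter_of_dominated_convergence (fun ξ => c * ‖cross v u ξ‖) ?_ ?_
      ((integrable_cross v u).norm.const_mul c) ?_
    · filter_upwards [self_mem_nhdsWithin] with x hx
      exact ((continuous_extZero_line g x hx).comp
        (continuous_const_mul (2 * Real.pi))).aestronglyMeasurable.mul
        (integrable_cross v u).aestronglyMeasurable
    · filter_upwards [self_mem_nhdsWithin] with x hx
      refine Eventually.of_forall fun ξ => ?_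
      rw [norm_mul]
      gcongr
      exact norm_extZero_le hc (by simpa using hx)
    · filter_upwards [ae_tendsto_boundaryFun g] with ξ hξ
      exact hξ.mul_const _
  refine h1.congr' ?_
  filter_upwards [self_mem_nhdsWithin] with x hx
  have hx0 : x < 0 := hx
  have h2 : ∀ ξ : ℝ, extZero g.1 (x + (2 * Real.pi * ξ : ℝ) * Complex.I) * cross v u ξ
      = ∫ t in Ioi 0, cross v u ξ * (ψ t * Complex.exp (x * t))
        * Complex.exp (2 * Real.pi * t * ξ * Complex.I) := by
    intro ξ
    rw [hg _ (by simpa using hx0), ← integral_mul_const]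
    refine integral_congr_ae (Eventually.of_forall fun t => ?_)
    simp only
    have : (x + (2 * Real.pi * ξ : ℝ) * Complex.I) * t
        = x * t + 2 * Real.pi * t * ξ * Complex.I := by
      push_cast
      ring
    rw [this, Complex.exp_add]
    ring
  simp_rw [h2]
  rw [integral_integral_swap]
  · refine integral_congr_ae (Eventually.of_forall fun t => ?_)
    simp only
    rw [inner_shift_eq_integral, ← integral_const_mul]
    refine integral_congr_ae (Eventually.of_forall fun ξ => ?_)
    simp only
    ring
  · have h3 : IntegrableOn (fun t : ℝ => ψ t * Complex.exp (x * t)) (Ioi 0) := by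
      refine Integrable.mono' ((integrableOn_exp_mul_Ioi hx0 0).const_mul C) (by fun_prop) ?_
      filter_upwards [ae_restrict_mem measurableSet_Ioi] with t ht
      rw [norm_mul, cexp_mul_norm, Complex.ofReal_re]
      gcongr
      exact hC t ht
    refine Integrable.mul_bdd (c := 1) ((integrable_cross v u).mul_prod h3) (by fun_prop) ?_
    refine Eventually.of_forall fun p => le_of_eq ?_
    rw [Complex.norm_exp]
    simp

/-! ### An approximate identity of resolvent symbols. -/

theorem re_natCast_add_one_pos (n : ℕ) : 0 < ((n : ℂ) + 1).re := by
  simp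
  positivity

/-- The symbols `(n + 1) / (n + 1 - z)`, an approximate identity for large `n`. -/
def approxOne (n : ℕ) : HInf :=
  algebraMap ℂ HInf (n + 1) * resolventSymbol (n + 1) (re_natCast_add_one_pos n)

theorem approxOne_apply (n : ℕ) (z : LeftHalfPlane) :
    (approxOne n).1 z = (n + 1) * (1 / (n + 1 - z.1)) := rfl

theorem norm_approxOne_le (n : ℕ) (z : LeftHalfPlane) : ‖(approxOne n).1 z‖ ≤ 1 := by
  have h1 : ((n : ℝ) + 1) ≤ ‖((n : ℂ) + 1 - z.1)‖ := by
    refine le_trans ?_ (Complex.re_le_norm _)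
    have := z.2
    simp
    linarith
  have h2 : (0 : ℝ) < n + 1 := by positivity
  rw [approxOne_apply, ← mul_div_assoc, mul_one, norm_div, div_le_one (h2.trans_le h1)]
  refine le_trans (le_of_eq ?_) h1
  exact_mod_cast Complex.norm_natCast (n + 1)

/-- The square has quadratic decay, so multiplying a bounded symbol by it produces one with a
Laplace density. -/
theorem norm_sq_approxOne_le (n : ℕ) (z : LeftHalfPlane) :
    ‖(approxOne n).1 z‖ ^ 2 ≤ ((n : ℝ) + 1) ^ 2 * (1 + z.1.im ^ 2)⁻¹ := by
  have h1 : 1 + z.1.im ^ 2 ≤ ‖((n : ℂ) + 1 - z.1)‖ ^ 2 := by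
    have := z.2
    rw [← Complex.normSq_eq_norm_sq, Complex.normSq_apply]
    simp
    nlinarith [(Nat.cast_nonneg n : (0 : ℝ) ≤ n), mul_nonneg (Nat.cast_nonneg n : (0 : ℝ) ≤ n)
      (neg_nonneg.2 this.le)]
  have h2 : ‖(n : ℂ) + 1‖ = n + 1 := by exact_mod_cast Complex.norm_natCast (n + 1)
  rw [approxOne_apply, norm_mul, mul_pow, h2, norm_div, norm_one, div_pow, one_pow, one_div]
  gcongr

theorem boundaryFun_approxOne (n : ℕ) (ω : ℝ) :
    boundaryFun (approxOne n).1 ω = (1 - ω * Complex.I * (1 / ((n : ℝ) + 1) : ℝ))⁻¹ := by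
  have hn : ((n : ℂ) + 1) ≠ 0 := by exact_mod_cast n.succ_ne_zero
  have hne : (n : ℂ) + 1 - ω * Complex.I ≠ 0 := by
    intro h
    have := congrArg Complex.re h
    simp at this
    have h0 : (0 : ℝ) < n + 1 := by positivity
    exact h0.ne' this
  have h : Tendsto (fun x : ℝ => extZero (approxOne n).1 (x + ω * Complex.I)) (𝓝[<] 0)
      (𝓝 ((n + 1) * (1 / (n + 1 - ω * Complex.I)))) := by
    have h1 : Tendsto (fun x : ℝ => ((n : ℂ) + 1) * (1 / (n + 1 - (x + ω * Complex.I)))) (𝓝[<] 0)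
        (𝓝 ((n + 1) * (1 / (n + 1 - ((0 : ℝ) + ω * Complex.I))))) := by
      refine Tendsto.const_mul _ (Tendsto.div tendsto_const_nhds ?_ (by simpa using hne))
      exact (Continuous.tendsto (by fun_prop) 0).mono_left nhdsWithin_le_nhds
    rw [Complex.ofReal_zero, zero_add] at h1
    refine h1.congr' ?_
    filter_upwards [self_mem_nhdsWithin] with x hx
    have hx' : (x + ω * Complex.I : ℂ).re < 0 := by simpa using hx
    rw [extZero_of_neg _ hx']
    rfl
  rw [boundaryFun_eq_of_tendsto h]
  push_cast
  have h2 : (1 - ω * Complex.I * (1 / ((n : ℂ) + 1))) = (n + 1 - ω * Complex.I) / (n + 1) := by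
    field_simp
  rw [h2, inv_div]
  ring

theorem tendsto_boundaryFun_approxOne (ω : ℝ) :
    Tendsto (fun n => boundaryFun (approxOne n).1 ω) atTop (𝓝 1) := by
  have h : Tendsto (fun n : ℕ => (1 - ω * Complex.I * (1 / ((n : ℝ) + 1) : ℝ))⁻¹) atTop
      (𝓝 (1 - ω * Complex.I * (0 : ℝ))⁻¹) := by
    refine Tendsto.inv₀ (tendsto_const_nhds.sub (Tendsto.const_mul _ ?_)) (by simp)
    exact (Complex.continuous_ofReal.tendsto 0).comp tendsto_one_div_add_atTop_nhds_zero_nat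
  simpa [boundaryFun_approxOne] using h

/-- Moved onto `v`, the shift goes to the right and keeps `v` in `L²(0,∞)`, which is orthogonal to
`u`. -/
theorem inner_shift_eq_zero {v u : Lp ℂ 2 (volume : Measure ℝ)} (hv : v ∈ L2pos) (hu : u ∈ L2posᗮ)
    {t : ℝ} (ht : 0 ≤ t) : inner ℂ v (shift t u) = 0 := by
  rw [inner_shift]
  exact (Submodule.mem_orthogonal _ _).1 hu _ (shift_neg_mem hv ht)

/-- Multiplication by the boundary function of an element of `HInf` preserves the orthogonal
complement of the Hardy space. -/
theorem integral_boundaryFun_mul_cross_eq_zero (g : HInf) {v u : Lp ℂ 2 (volume : Measure ℝ)}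
    (hv : v ∈ L2pos) (hu : u ∈ L2posᗮ) :
    ∫ ξ, boundaryFun g.1 (2 * Real.pi * ξ) * cross v u ξ = 0 := by
  obtain ⟨c, hc⟩ := g.2.2
  have hc0 : 0 ≤ c := (norm_nonneg _).trans (hc ⟨-1, by simp⟩)
  -- Each `k n` is a superposition of left translations, every one of which preserves the orthogonal
  -- complement. The limit `n → ∞` then recovers `g`.
  let k : ℕ → HInf := fun n => g * (approxOne n * approxOne n)
  have hkapp : ∀ n z, ‖(k n).1 z‖ = ‖g.1 z‖ * ‖(approxOne n).1 z‖ ^ 2 := by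
    intro n z
    rw [sq, ← norm_mul, ← norm_mul]
    rfl
  have hk : ∀ n, ∫ ξ, boundaryFun (k n).1 (2 * Real.pi * ξ) * cross v u ξ = 0 := by
    intro n
    obtain ⟨ψ, hψ, ⟨C, hC⟩, hψk⟩ := exists_laplace_density (k n).2.1
      (c := c * ((n : ℝ) + 1) ^ 2) (fun z hz => by
        rw [extZero_of_neg _ hz, hkapp, mul_assoc]
        exact mul_le_mul (hc _) (norm_sq_approxOne_le n ⟨z, hz⟩) (by positivity) hc0)
    refine tendsto_nhds_unique (tendsto_integral_inner_shift hψ (fun t _ => hC t) hψk v u) ?_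
    refine tendsto_const_nhds.congr fun x => ?_
    rw [setIntegral_eq_zero_of_forall_eq_zero]
    intro t ht
    rw [inner_shift_eq_zero hv hu (le_of_lt ht), mul_zero]
  have hlim : Tendsto (fun n => ∫ ξ, boundaryFun (k n).1 (2 * Real.pi * ξ) * cross v u ξ) atTop
      (𝓝 (∫ ξ, boundaryFun g.1 (2 * Real.pi * ξ) * cross v u ξ)) := by
    refine tendsto_integral_of_dominated_convergence (fun ξ => max c 0 * ‖cross v u ξ‖)
      (fun n => (integrable_boundaryFun_mul_cross (k n) v u).aestronglyMeasurable)
      ((integrable_cross v u).norm.const_mul _) (fun n => Eventually.of_forall fun ξ => ?_) ?_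
    · refine norm_boundaryFun_mul_cross_le (k n) (fun z => ?_) v u ξ
      rw [hkapp]
      exact (mul_le_of_le_one_right (norm_nonneg _)
        (pow_le_one₀ (norm_nonneg _) (norm_approxOne_le n z))).trans (hc z)
    · have h1 : ∀ᵐ ξ : ℝ, ∀ n, boundaryFun (k n).1 (2 * Real.pi * ξ)
          = boundaryFun g.1 (2 * Real.pi * ξ) * (boundaryFun (approxOne n).1 (2 * Real.pi * ξ)
            * boundaryFun (approxOne n).1 (2 * Real.pi * ξ)) := by
        rw [ae_all_iff]
        intro n
        filter_upwards [ae_boundaryFun_mul g (approxOne n * approxOne n),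
          ae_boundaryFun_mul (approxOne n) (approxOne n)] with ξ h2 h3
        rw [h2, h3]
      filter_upwards [h1] with ξ hξ
      simp only [hξ]
      have h2 := tendsto_boundaryFun_approxOne (2 * Real.pi * ξ)
      simpa using (((h2.mul h2).const_mul (boundaryFun g.1 (2 * Real.pi * ξ))).mul_const
        (cross v u ξ))
  simp only [hk] at hlim
  exact tendsto_nhds_unique hlim tendsto_const_nhds

theorem L2pos_ext {f h : L2pos} (H : ∀ v : L2pos, inner ℂ v f = inner ℂ v h) : f = h :=
  ext_inner_left ℂ H

/-- The Toeplitz operators depend multiplicatively on their symbols. -/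
theorem toeplitz_mul (f g : HInf) (h : L2pos) :
    toeplitz (f * g) h = toeplitz f (toeplitz g h) := by
  refine L2pos_ext fun v => ?_
  -- `w` is the product with symbol `g` before projection. It differs from `M_g h` by an element of
  -- the orthogonal complement, which contributes nothing after multiplication by `f`, so the inner
  -- projection may be omitted.
  let w := (Lp.fourierTransformₗᵢ ℝ ℂ).symm
    (mulLp (boundary g) (Lp.fourierTransformₗᵢ ℝ ℂ (h : Lp ℂ 2 (volume : Measure ℝ))))
  have hw : ∀ v : L2pos, inner ℂ (v : Lp ℂ 2 (volume : Measure ℝ)) w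
      = inner ℂ v (toeplitz g h) := by
    intro v
    rw [inner_toeplitz, ← inner_mulLp_boundary, LinearIsometryEquiv.inner_map_eq_flip]
  have hperp : w - toeplitz g h ∈ L2posᗮ := by
    rw [Submodule.mem_orthogonal]
    intro v hv
    rw [inner_sub_right, hw ⟨v, hv⟩, sub_eq_zero]
    rfl
  have h0 := integral_boundaryFun_mul_cross_eq_zero f v.2 hperp
  have h1 : ∫ ξ, boundaryFun f.1 (2 * Real.pi * ξ) * cross v (w - toeplitz g h) ξ
      = (∫ ξ, boundaryFun f.1 (2 * Real.pi * ξ) * cross v w ξ)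
        - ∫ ξ, boundaryFun f.1 (2 * Real.pi * ξ) * cross v (toeplitz g h) ξ := by
    rw [← integral_sub (integrable_boundaryFun_mul_cross f _ _)
      (integrable_boundaryFun_mul_cross f _ _)]
    refine integral_congr_ae ?_
    filter_upwards [cross_sub_right v w (toeplitz g h)] with ξ hξ
    rw [hξ, mul_sub]
  rw [inner_toeplitz, inner_toeplitz f, ← sub_eq_zero.1 (h1.symm.trans h0)]
  refine integral_congr_ae ?_
  filter_upwards [ae_boundaryFun_mul f g, cross_mulLp v h (boundary g),
    (memLp_boundaryFun g).coeFn_toLp] with ξ h2 h3 h4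
  rw [h2, h3, boundary, h4, mul_assoc]

theorem toeplitz_add (f g : HInf) (h : L2pos) :
    toeplitz (f + g) h = toeplitz f h + toeplitz g h := by
  refine L2pos_ext fun v => ?_
  rw [inner_add_right, inner_toeplitz, inner_toeplitz, inner_toeplitz,
    ← integral_add (integrable_boundaryFun_mul_cross f _ _)
      (integrable_boundaryFun_mul_cross g _ _)]
  refine integral_congr_ae ?_
  filter_upwards [ae_boundaryFun_add f g] with ξ hξ
  rw [hξ, add_mul]

theorem toeplitz_algebraMap (c : ℂ) (h : L2pos) : toeplitz (algebraMap ℂ HInf c) h = c • h := by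
  refine L2pos_ext fun v => ?_
  rw [inner_toeplitz, Submodule.coe_inner, Submodule.coe_smul, inner_smul_right]
  simp only [boundaryFun_algebraMap]
  rw [integral_const_mul, integral_cross]

/-! ### The generator of a semigroup -/

section Generator

variable {X : Type*} [NormedAddCommGroup X] [NormedSpace ℂ X] (T : C0Semigroup X)

theorem C0Semigroup.op_comm (s t : ℝ≥0) (x : X) : T.op s (T.op t x) = T.op t (T.op s x) := by
  rw [← mul_apply_eq_comp, ← mul_apply_eq_comp, ← T.op_add, ← T.op_add, add_comm]

theorem C0Semigroup.op_add_apply (s t : ℝ≥0) (x : X) : T.op (s + t) x = T.op s (T.op t x) := by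
  rw [T.op_add, mul_apply_eq_comp]

theorem C0Semigroup.op_zero_apply (x : X) : T.op 0 x = x := by
  rw [T.op_zero]
  rfl

theorem C0Semigroup.continuous_real_orbit (x : X) : Continuous fun t : ℝ => T.op t.toNNReal x :=
  (T.continuous_orbit x).comp continuous_real_toNNReal

theorem C0Semigroup.tendsto_generator (x : T.generator.domain) :
    Tendsto (fun h : ℝ≥0 => ((h : ℝ) : ℂ)⁻¹ • (T.op h x - x)) (𝓝[>] 0) (𝓝 (T.generator x)) :=
  tendsto_nhds_limUnder x.2

theorem C0Semigroup.generator_of_tendsto {x z : X}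
    (h : Tendsto (fun h : ℝ≥0 => ((h : ℝ) : ℂ)⁻¹ • (T.op h x - x)) (𝓝[>] 0) (𝓝 z)) :
    ∃ hx : x ∈ T.generator.domain, T.generator ⟨x, hx⟩ = z :=
  ⟨⟨z, h⟩, h.limUnder_eq⟩

theorem C0Semigroup.commutesWith_of_comm {P : X →L[ℂ] X} (hP : ∀ t x, P (T.op t x) = T.op t (P x)) :
    CommutesWith P T.generator := by
  intro x
  refine T.generator_of_tendsto (((P.continuous.tendsto _).comp (T.tendsto_generator x)).congr
    fun h => ?_)
  simp only [Function.comp_apply, map_smul, map_sub, hP]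

theorem C0Semigroup.generator_op (t : ℝ≥0) (x : T.generator.domain) :
    T.generator ⟨T.op t x, T.op_mem_domain t x⟩ = T.op t (T.generator x) :=
  (T.commutesWith_of_comm (P := T.op t) (fun s x => T.op_comm t s x) x).2

theorem subOp_apply (A : X →ₗ.[ℂ] X) (μ : ℂ) (x : A.domain) : subOp A μ x = μ • (x : X) - A x := rfl

end Generator

/-! ### Operator-valued Laplace integrals -/

section LaplaceOp

variable {X : Type*} [NormedAddCommGroup X] [NormedSpace ℂ X] {T : C0Semigroup X}

/-- Continuous functions which are bounded on `(0, ∞)`. -/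
def IsDensity (ψ : ℝ → ℂ) : Prop := Continuous ψ ∧ ∃ C : ℝ, ∀ t, 0 < t → ‖ψ t‖ ≤ C

theorem exists_norm_op_le (hT : T.IsExpStable) : ∃ M ω : ℝ, 0 ≤ M ∧ ω < 0 ∧
    ∀ t : ℝ, 0 ≤ t → ∀ x, ‖T.op t.toNNReal x‖ ≤ M * Real.exp (ω * t) * ‖x‖ := by
  obtain ⟨M, ω, hω, hM⟩ := hT
  refine ⟨M, ω, ?_, hω, fun t ht x => ?_⟩
  · simpa using (norm_nonneg _).trans (hM 0)
  · have := hM t.toNNReal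
    rw [Real.coe_toNNReal t ht] at this
    exact (ContinuousLinearMap.le_opNorm _ _).trans (by gcongr)

theorem integrableOn_smul_op (hT : T.IsExpStable) {ψ : ℝ → ℂ} (hψ : IsDensity ψ) (x : X) :
    IntegrableOn (fun t : ℝ => ψ t • T.op t.toNNReal x) (Ioi 0) := by
  obtain ⟨M, ω, hM0, hω, hM⟩ := exists_norm_op_le hT
  obtain ⟨hc, C, hC⟩ := hψ
  refine Integrable.mono' ((integrableOn_exp_mul_Ioi hω 0).const_mul (C * (M * ‖x‖)))
    (hc.smul (T.continuous_real_orbit x)).aestronglyMeasurable ?_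
  filter_upwards [ae_restrict_mem measurableSet_Ioi] with t ht
  rw [norm_smul]
  have h1 := hC t ht
  calc ‖ψ t‖ * ‖T.op t.toNNReal x‖ ≤ C * (M * Real.exp (ω * t) * ‖x‖) :=
        mul_le_mul h1 (hM t (le_of_lt ht) x) (norm_nonneg _) ((norm_nonneg _).trans h1)
    _ = _ := by ring

/-- The operator `x ↦ ∫ ψ t • T t x dt`. -/
def laplaceOp (hT : T.IsExpStable) {ψ : ℝ → ℂ} (hψ : IsDensity ψ) : X →L[ℂ] X :=
  LinearMap.mkContinuousOfExistsBound
    { toFun := fun x => ∫ t in Ioi 0, ψ t • T.op t.toNNReal x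
      map_add' := fun x y => by
        rw [← integral_add (integrableOn_smul_op hT hψ x) (integrableOn_smul_op hT hψ y)]
        simp only [map_add, smul_add]
      map_smul' := fun c x => by
        rw [RingHom.id_apply, ← integral_smul]
        refine integral_congr_ae (Eventually.of_forall fun t => ?_)
        simp only [map_smul]
        exact smul_comm _ _ _ } <| by
    obtain ⟨M, ω, hM0, hω, hM⟩ := exists_norm_op_le hT
    obtain ⟨hc, C, hC⟩ := hψ
    refine ⟨∫ t in Ioi 0, C * M * Real.exp (ω * t), fun x => ?_⟩
    rw [← integral_mul_const]
    refine norm_integral_le_of_norm_le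
      (((integrableOn_exp_mul_Ioi hω 0).const_mul (C * M)).mul_const _) ?_
    filter_upwards [ae_restrict_mem measurableSet_Ioi] with t ht
    rw [norm_smul]
    have h1 := hC t ht
    calc ‖ψ t‖ * ‖T.op t.toNNReal x‖ ≤ C * (M * Real.exp (ω * t) * ‖x‖) :=
          mul_le_mul h1 (hM t (le_of_lt ht) x) (norm_nonneg _) ((norm_nonneg _).trans h1)
      _ = _ := by ring

theorem laplaceOp_apply (hT : T.IsExpStable) {ψ : ℝ → ℂ} (hψ : IsDensity ψ) (x : X) :
    laplaceOp hT hψ x = ∫ t in Ioi 0, ψ t • T.op t.toNNReal x := rfl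

variable [CompleteSpace X]

theorem map_laplaceOp (hT : T.IsExpStable) {ψ : ℝ → ℂ} (hψ : IsDensity ψ) {Y : Type*}
    [NormedAddCommGroup Y] [NormedSpace ℂ Y] [CompleteSpace Y] (P : X →L[ℂ] Y) (x : X) :
    P (laplaceOp hT hψ x) = ∫ t in Ioi 0, ψ t • P (T.op t.toNNReal x) := by
  rw [laplaceOp_apply, ← P.integral_comp_comm (integrableOn_smul_op hT hψ x)]
  simp only [map_smul]

theorem laplaceOp_comm (hT : T.IsExpStable) {ψ : ℝ → ℂ} (hψ : IsDensity ψ) {P : X →L[ℂ] X}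
    (hP : ∀ t x, P (T.op t x) = T.op t (P x)) (x : X) :
    P (laplaceOp hT hψ x) = laplaceOp hT hψ (P x) := by
  rw [map_laplaceOp, laplaceOp_apply]
  simp only [hP]

theorem laplaceOp_op (hT : T.IsExpStable) {ψ : ℝ → ℂ} (hψ : IsDensity ψ) (t : ℝ≥0) (x : X) :
    laplaceOp hT hψ (T.op t x) = T.op t (laplaceOp hT hψ x) :=
  (laplaceOp_comm hT hψ (P := T.op t) (fun s x => T.op_comm t s x) x).symm

/-! ### The resolvent -/

theorem isDensity_exp {μ : ℂ} (hμ : 0 < μ.re) : IsDensity fun t : ℝ => Complex.exp (-μ * t) := by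
  refine ⟨by fun_prop, 1, fun t ht => ?_⟩
  rw [cexp_mul_norm, Complex.neg_re, neg_mul]
  exact Real.exp_le_one_iff.2 (neg_nonpos.2 (mul_pos hμ ht).le)

/-- The resolvent as a Laplace integral. -/
def resOp (hT : T.IsExpStable) {μ : ℂ} (hμ : 0 < μ.re) : X →L[ℂ] X :=
  laplaceOp hT (isDensity_exp hμ)

/-- Substituting `t + h` for `t` in the Laplace integral leaves its tail from `h`. Written with an
integral over `[0, h]`, the right-hand side can be differentiated at `h = 0`. -/
theorem op_resOp (hT : T.IsExpStable) {μ : ℂ} (hμ : 0 < μ.re) (h : ℝ≥0) (x : X) :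
    T.op h (resOp hT hμ x) = Complex.exp (μ * (h : ℝ)) • (resOp hT hμ x
      - ∫ t in (0 : ℝ)..h, Complex.exp (-μ * t) • T.op t.toNNReal x) := by
  have hi := integrableOn_smul_op hT (isDensity_exp hμ) x
  have h1 : T.op h (resOp hT hμ x) = ∫ t in Ioi (0 : ℝ), Complex.exp (μ * (h : ℝ)) •
      (fun t : ℝ => Complex.exp (-μ * t) • T.op t.toNNReal x) (t + h) := by
    rw [resOp, map_laplaceOp]
    refine setIntegral_congr_fun measurableSet_Ioi fun t ht => ?_
    have ht0 : 0 ≤ t := le_of_lt ht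
    simp only
    rw [Real.toNNReal_add ht0 (NNReal.coe_nonneg h), Real.toNNReal_coe, add_comm t.toNNReal, T.op_add_apply, smul_smul,
      ← Complex.exp_add]
    congr 2
    push_cast
    ring
  have h2 := (measurePreserving_add_right (volume : Measure ℝ) h).setIntegral_preimage_emb
    (measurableEmbedding_addRight (h : ℝ))
    (fun t : ℝ => Complex.exp (-μ * t) • T.op t.toNNReal x) (Ioi (h : ℝ))
  rw [preimage_add_const_Ioi, sub_self] at h2
  rw [h1, integral_smul, h2]
  congr 1
  rw [eq_sub_iff_add_eq, add_comm]
  exact intervalIntegral.integral_interval_add_Ioi hi (hi.mono_set (Ioi_subset_Ioi h.2))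

theorem resOp_mem_domain (hT : T.IsExpStable) {μ : ℂ} (hμ : 0 < μ.re) (x : X) :
    ∃ hx : resOp hT hμ x ∈ T.generator.domain,
      T.generator ⟨resOp hT hμ x, hx⟩ = μ • resOp hT hμ x - x := by
  refine T.generator_of_tendsto ?_
  have hc : Continuous fun t : ℝ => Complex.exp (-μ * t) • T.op t.toNNReal x :=
    Continuous.smul (by fun_prop) (T.continuous_real_orbit x)
  have h1 : HasDerivAt (fun h : ℝ => ∫ t in (0 : ℝ)..h, Complex.exp (-μ * t) • T.op t.toNNReal x)
      x 0 := by
    have := intervalIntegral.integral_hasDerivAt_right (hc.intervalIntegrable 0 0)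
      (hc.stronglyMeasurableAtFilter _ _) hc.continuousAt
    simpa [T.op_zero_apply] using this
  have h2 : HasDerivAt (fun h : ℝ => Complex.exp (μ * h)) μ 0 := by
    have := ((Complex.ofRealCLM.hasDerivAt (x := (0 : ℝ))).const_mul μ).cexp
    simpa using this
  have h3 : HasDerivAt (fun h : ℝ => Complex.exp (μ * h) • (resOp hT hμ x
      - ∫ t in (0 : ℝ)..h, Complex.exp (-μ * t) • T.op t.toNNReal x))
      (μ • resOp hT hμ x - x) 0 := by
    have := h2.smul (h1.const_sub (resOp hT hμ x))
    convert! this using 1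
    simp
    abel
  have hcoe : Tendsto (fun h : ℝ≥0 => (h : ℝ)) (𝓝[>] 0) (𝓝[>] 0) := by
    refine tendsto_nhdsWithin_iff.2 ⟨?_, ?_⟩
    · exact (NNReal.continuous_coe.tendsto 0).mono_left nhdsWithin_le_nhds
    · filter_upwards [self_mem_nhdsWithin] with h hh
      exact_mod_cast hh
  refine (h3.tendsto_slope_zero_right.comp hcoe).congr fun h => ?_
  simp only [Function.comp_apply, zero_add]
  rw [← op_resOp, ← Complex.ofReal_inv, Complex.coe_smul]
  simp

/-- The Laplace integral commutes with the semigroup, hence with the generator, so the formula for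
the generator on its range also gives a left inverse. -/
theorem resOp_subOp (hT : T.IsExpStable) {μ : ℂ} (hμ : 0 < μ.re) (x : T.generator.domain) :
    resOp hT hμ (subOp T.generator μ x) = x := by
  obtain ⟨hx, h⟩ := T.commutesWith_of_comm (P := resOp hT hμ)
    (fun t x => laplaceOp_op hT (isDensity_exp hμ) t x) x
  obtain ⟨hx', h'⟩ := resOp_mem_domain hT hμ (x : X)
  rw [h] at h'
  rw [subOp_apply, map_sub, map_smul, h']
  abel

theorem subOp_resOp (hT : T.IsExpStable) {μ : ℂ} (hμ : 0 < μ.re) (x : X) :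
    subOp T.generator μ ⟨resOp hT hμ x, (resOp_mem_domain hT hμ x).1⟩ = x := by
  rw [subOp_apply, (resOp_mem_domain hT hμ x).2]
  abel

theorem mem_resSet (hT : T.IsExpStable) {μ : ℂ} (hμ : 0 < μ.re) : μ ∈ resSet T.generator := by
  refine ⟨⟨fun x y hxy => ?_, fun x => ⟨_, subOp_resOp hT hμ x⟩⟩, ‖resOp hT hμ‖, fun x => ?_⟩
  · have := congrArg (resOp hT hμ) hxy
    rw [resOp_subOp, resOp_subOp] at this
    exact Subtype.ext this
  · rw [← resOp_subOp hT hμ x, resOp_subOp hT hμ x]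
    nth_rewrite 1 [← resOp_subOp hT hμ x]
    exact (resOp hT hμ).le_opNorm _

theorem res_eq_resOp (hT : T.IsExpStable) {μ : ℂ} (hμ : 0 < μ.re) (x : X) :
    res T.generator μ x = ⟨resOp hT hμ x, (resOp_mem_domain hT hμ x).1⟩ := by
  rw [res, dif_pos (mem_resSet hT hμ)]
  refine (LinearEquiv.symm_apply_eq _).2 ?_
  exact (subOp_resOp hT hμ x).symm

/-- The substitution `t = u/s` turns `sR(s,A)x` into `∫ exp(-u) T(u/s)x du`. Strong continuity at
`0` and dominated convergence give the limit. -/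
theorem tendsto_smul_resOp (hT : T.IsExpStable) (x : X) :
    Tendsto (fun s : ℝ => (s : ℂ) • (res T.generator s x : X)) atTop (𝓝 x) := by
  obtain ⟨M, ω, hM0, hω, hM⟩ := exists_norm_op_le hT
  have h1 : Tendsto (fun s : ℝ => ∫ u in Ioi (0 : ℝ), Complex.exp (-u) • T.op (s⁻¹ * u).toNNReal x)
      atTop (𝓝 (∫ u in Ioi (0 : ℝ), Complex.exp (-u) • x)) := by
    refine tendsto_integral_filter_of_dominated_convergence
      (fun u => Real.exp (-u) * (M * ‖x‖)) ?_ ?_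
      ((integrableOn_exp_neg_Ioi 0).mul_const _) ?_
    · refine Eventually.of_forall fun s => Continuous.aestronglyMeasurable ?_
      exact Continuous.smul (by fun_prop)
        ((T.continuous_real_orbit x).comp (continuous_const_mul s⁻¹))
    · filter_upwards [eventually_gt_atTop 0] with s hs
      filter_upwards [ae_restrict_mem measurableSet_Ioi] with u hu
      have hu' : 0 ≤ s⁻¹ * u := mul_nonneg (inv_nonneg.2 hs.le) (le_of_lt hu)
      rw [norm_smul, Complex.norm_exp]
      refine mul_le_mul (by simp) ((hM _ hu' x).trans ?_) (norm_nonneg _) (Real.exp_nonneg _)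
      gcongr
      exact mul_le_of_le_one_right hM0
        (Real.exp_le_one_iff.2 (mul_nonpos_of_nonpos_of_nonneg hω.le hu'))
    · refine Eventually.of_forall fun u => Tendsto.const_smul ?_ _
      have h2 : Tendsto (fun s : ℝ => s⁻¹ * u) atTop (𝓝 (0 * u)) :=
        tendsto_inv_atTop_zero.mul_const u
      have h3 := ((T.continuous_real_orbit x).tendsto (0 * u)).comp h2
      simpa [T.op_zero_apply, Function.comp_def] using h3
  have h2 : ∫ u in Ioi (0 : ℝ), Complex.exp (-u) • x = x := by
    rw [integral_smul_const]
    have : ∫ u in Ioi (0 : ℝ), Complex.exp (-u) = 1 := by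
      have h := integral_exp_neg_Ioi_zero
      rw [← Complex.ofReal_inj, ← integral_complex_ofReal] at h
      simpa using h
    rw [this, one_smul]
  rw [h2] at h1
  refine h1.congr' ?_
  filter_upwards [eventually_gt_atTop 0] with s hs
  have hs' : 0 < (s : ℂ).re := by simpa using hs
  rw [res_eq_resOp hT hs']
  simp only [resOp]
  rw [laplaceOp_apply]
  have h3 := integral_comp_mul_left_Ioi
    (fun u : ℝ => Complex.exp (-(s : ℂ) * u) • T.op u.toNNReal x) 0 (inv_pos.2 hs)
  rw [mul_zero, inv_inv] at h3
  rw [Complex.coe_smul, ← h3]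
  refine integral_congr_ae (Eventually.of_forall fun u => ?_)
  simp only
  congr 2
  have : (s : ℂ) ≠ 0 := by exact_mod_cast hs.ne'
  push_cast
  field_simp

theorem denseRange_resOp (hT : T.IsExpStable) {μ : ℂ} (hμ : 0 < μ.re) :
    DenseRange (resOp hT hμ) := by
  intro x
  refine mem_closure_of_tendsto (tendsto_smul_resOp hT x) (Eventually.of_forall fun s => ?_)
  exact ⟨_, resOp_subOp hT hμ ((s : ℂ) • res T.generator s x)⟩

/-- A bounded operator commuting with the generator commutes with the semigroup. -/
theorem op_comm_of_commutesWith (hT : T.IsExpStable) {P : X →L[ℂ] X}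
    (hP : CommutesWith P T.generator) (t : ℝ≥0) (x : X) : P (T.op t x) = T.op t (P x) := by
  have hres : ∀ (μ : ℂ) (hμ : 0 < μ.re) (x : X), P (resOp hT hμ x) = resOp hT hμ (P x) := by
    intro μ hμ x
    obtain ⟨hx, h⟩ := hP ⟨resOp hT hμ x, (resOp_mem_domain hT hμ x).1⟩
    have h1 : subOp T.generator μ ⟨P (resOp hT hμ x), hx⟩ = P x := by
      rw [subOp_apply, h, (resOp_mem_domain hT hμ x).2, map_sub, map_smul]
      abel
    rw [← h1, resOp_subOp]
  -- The weight `exp(-t)` makes the Fourier transform of `f` at `ξ` equal to `R(μ,A)Px - PR(μ,A)x`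
  -- with `μ = 1 + 2πiξ`, which vanishes. Since `T(0) = 1`, `f` is zero for `t ≤ 0` and continuous
  -- on the whole line, so inversion gives `f = 0` everywhere.
  let f : ℝ → X := fun t =>
    Complex.exp (-(1 : ℂ) * t) • (T.op t.toNNReal (P x) - P (T.op t.toNNReal x))
  have hfc : Continuous f := Continuous.smul (by fun_prop)
    ((T.continuous_real_orbit (P x)).sub (P.continuous.comp (T.continuous_real_orbit x)))
  have hf0 : ∀ t ≤ 0, f t = 0 := by
    intro t ht
    simp only [f, Real.toNNReal_of_nonpos ht, T.op_zero_apply, sub_self, smul_zero]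
  have h1 : 0 < (1 : ℂ).re := by simp
  have hPi : ∀ (μ : ℂ) (hμ : 0 < μ.re), IntegrableOn
      (fun t : ℝ => Complex.exp (-μ * t) • P (T.op t.toNNReal x)) (Ioi 0) := fun μ hμ => by
    have := P.integrable_comp (integrableOn_smul_op hT (isDensity_exp hμ) x)
    simp only [map_smul] at this
    exact this
  have hfi : Integrable f := by
    refine (integrableOn_iff_integrable_of_support_subset (s := Ioi 0) ?_).1 ?_
    · intro t ht
      by_contra h
      exact ht (hf0 t (not_lt.1 h))
    · simp only [f, smul_sub]
      exact (integrableOn_smul_op hT (isDensity_exp h1) (P x)).sub (hPi 1 h1)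
  have hF : 𝓕 f = 0 := by
    ext ξ
    have hμ : 0 < (1 + 2 * Real.pi * ξ * Complex.I).re := by simp
    rw [Real.fourier_real_eq_integral_exp_smul,
      ← setIntegral_eq_integral_of_forall_compl_eq_zero (s := Ioi 0)]
    · have h2 : ∀ t : ℝ, Complex.exp ((-2 * Real.pi * t * ξ : ℝ) * Complex.I) • f t
          = Complex.exp (-(1 + 2 * Real.pi * ξ * Complex.I) * t) • T.op t.toNNReal (P x)
            - Complex.exp (-(1 + 2 * Real.pi * ξ * Complex.I) * t) • P (T.op t.toNNReal x) := by
        intro t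
        rw [← smul_sub, smul_smul, ← Complex.exp_add]
        congr 2
        push_cast
        ring
      simp only [h2]
      rw [integral_sub (integrableOn_smul_op hT (isDensity_exp hμ) (P x)) (hPi _ hμ),
        ← map_laplaceOp hT (isDensity_exp hμ) P, ← laplaceOp_apply hT (isDensity_exp hμ)]
      exact sub_eq_zero.2 (hres _ hμ x).symm
    · intro t ht
      rw [hf0 t (not_lt.1 ht), smul_zero]
  have hinv := hfc.fourierInv_fourier_eq hfi (by rw [hF]; exact integrable_zero _ _ _)
  have h2 : f t = 0 := by
    rw [← hinv, hF, Real.fourierInv_eq']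
    simp
  simp only [f, Real.toNNReal_coe, smul_eq_zero, Complex.exp_ne_zero, false_or, sub_eq_zero] at h2
  exact h2.symm

end LaplaceOp

/-! ### Toeplitz operators applied to orbits -/

section Orbit

variable {X : Type*} [NormedAddCommGroup X] [NormedSpace ℂ X] {T : C0Semigroup X}

theorem memLp_expFun {a : ℝ} (ha : a < 0) :
    MemLp (indicator (Ioi 0) fun t : ℝ => Complex.exp (a * t)) 2 volume := by
  have hm : AEStronglyMeasurable (fun t : ℝ => Complex.exp (a * t))
      (volume.restrict (Ioi 0)) := by fun_prop
  rw [memLp_indicator_iff_restrict measurableSet_Ioi, memLp_two_iff_integrable_sq_norm hm]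
  have hi : Integrable (fun t : ℝ => Real.exp (2 * a * t)) (volume.restrict (Ioi 0)) :=
    integrableOn_exp_mul_Ioi (by linarith) 0
  refine hi.congr (Eventually.of_forall fun t => ?_)
  simp only
  rw [cexp_mul_norm, Complex.ofReal_re, ← Real.exp_nat_mul]
  congr 1
  push_cast
  ring

theorem coeFn_orbit (hT : T.IsExpStable) (x : X) (y : StrongDual ℂ X) :
    ((orbit hT x y : Lp ℂ 2 (volume : Measure ℝ)) : ℝ → ℂ) =ᵐ[volume] orbitFun T x y :=
  (memLp_orbitFun hT x y).coeFn_toLp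

theorem orbitFun_of_pos (x : X) (y : StrongDual ℂ X) {t : ℝ} (ht : 0 < t) :
    orbitFun T x y t = y (T.op t.toNNReal x) := indicator_of_mem ht _

theorem coeFn_orbit_restrict (hT : T.IsExpStable) (x : X) (y : StrongDual ℂ X) :
    ((orbit hT x y : Lp ℂ 2 (volume : Measure ℝ)) : ℝ → ℂ) =ᵐ[volume.restrict (Ioi 0)]
      fun t => y (T.op t.toNNReal x) := by
  filter_upwards [ae_restrict_of_ae (coeFn_orbit hT x y), ae_restrict_mem measurableSet_Ioi]
    with t h ht
  rw [h, orbitFun_of_pos x y ht]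

theorem L2pos_ext_ae {f h : L2pos}
    (H : ((f : Lp ℂ 2 (volume : Measure ℝ)) : ℝ → ℂ) =ᵐ[volume.restrict (Ioi 0)]
      (h : Lp ℂ 2 (volume : Measure ℝ))) : f = h := by
  refine Subtype.ext (Lp.ext ?_)
  have hf := (ae_restrict_iff' measurableSet_Iic).1 ((mem_L2pos_iff _).1 f.2)
  have hh := (ae_restrict_iff' measurableSet_Iic).1 ((mem_L2pos_iff _).1 h.2)
  filter_upwards [hf, hh, (ae_restrict_iff' measurableSet_Ioi).1 H] with t h1 h2 h3
  rcases le_or_gt t 0 with ht | ht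
  · rw [h1 ht, h2 ht]
  · exact h3 ht

theorem orbit_add (hT : T.IsExpStable) (x x' : X) (y : StrongDual ℂ X) :
    orbit hT (x + x') y = orbit hT x y + orbit hT x' y := by
  refine L2pos_ext_ae ?_
  rw [Submodule.coe_add]
  filter_upwards [coeFn_orbit_restrict hT (x + x') y, coeFn_orbit_restrict hT x y,
    coeFn_orbit_restrict hT x' y, ae_restrict_of_ae (Lp.coeFn_add
      (orbit hT x y : Lp ℂ 2 (volume : Measure ℝ)) (orbit hT x' y))] with t h1 h2 h3 h4
  rw [h1, h4, Pi.add_apply, h2, h3, map_add, map_add]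

theorem orbit_smul (hT : T.IsExpStable) (c : ℂ) (x : X) (y : StrongDual ℂ X) :
    orbit hT (c • x) y = c • orbit hT x y := by
  refine L2pos_ext_ae ?_
  rw [Submodule.coe_smul]
  filter_upwards [coeFn_orbit_restrict hT (c • x) y, coeFn_orbit_restrict hT x y,
    ae_restrict_of_ae (Lp.coeFn_smul c (orbit hT x y : Lp ℂ 2 (volume : Measure ℝ)))]
    with t h1 h2 h3
  rw [h1, h3, Pi.smul_apply, h2, map_smul, map_smul]

theorem exists_norm_orbit_le (hT : T.IsExpStable) :
    ∃ c : ℝ, 0 ≤ c ∧ ∀ x y, ‖orbit hT x y‖ ≤ c * ‖y‖ * ‖x‖ := by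
  obtain ⟨M, ω, hM0, hω, hM⟩ := exists_norm_op_le hT
  refine ⟨M * ‖(memLp_expFun hω).toLp _‖, by positivity, fun x y => ?_⟩
  have h := Lp.norm_le_mul_norm_of_ae_le_mul (c := ‖y‖ * (M * ‖x‖))
    (f := (orbit hT x y : Lp ℂ 2 (volume : Measure ℝ))) (g := (memLp_expFun hω).toLp _) ?_
  · rw [Submodule.coe_norm]
    exact h.trans_eq (by ring)
  · filter_upwards [coeFn_orbit hT x y, (memLp_expFun hω).coeFn_toLp] with t h1 h2
    rw [h1, h2]
    by_cases ht : 0 < t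
    · rw [orbitFun_of_pos x y ht, indicator_of_mem (by exact ht), cexp_mul_norm, Complex.ofReal_re]
      calc ‖y (T.op t.toNNReal x)‖ ≤ ‖y‖ * (M * Real.exp (ω * t) * ‖x‖) :=
            (y.le_opNorm _).trans (by gcongr; exact hM t ht.le x)
        _ = _ := by ring
    · rw [orbitFun, indicator_of_notMem (by exact ht), indicator_of_notMem (by exact ht)]
      simp

/-- For fixed `y`, the function `t ↦ ⟨y, T(t) x⟩` as a bounded linear function of `x`. -/
def orbitL (hT : T.IsExpStable) (y : StrongDual ℂ X) : X →L[ℂ] L2pos :=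
  LinearMap.mkContinuousOfExistsBound
    { toFun := fun x => orbit hT x y
      map_add' := fun x x' => orbit_add hT x x' y
      map_smul' := fun c x => orbit_smul hT c x y } <| by
    obtain ⟨c, -, hc⟩ := exists_norm_orbit_le hT
    exact ⟨c * ‖y‖, fun x => hc x y⟩

theorem orbitL_apply (hT : T.IsExpStable) (y : StrongDual ℂ X) (x : X) :
    orbitL hT y x = orbit hT x y := rfl

theorem orbit_comp (hT : T.IsExpStable) {P : X →L[ℂ] X} (hP : ∀ t x, P (T.op t x) = T.op t (P x))
    (x : X) (y : StrongDual ℂ X) : orbit hT x (y ∘L P) = orbit hT (P x) y := by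
  refine L2pos_ext_ae ?_
  filter_upwards [coeFn_orbit_restrict hT x (y ∘L P), coeFn_orbit_restrict hT (P x) y]
    with t h1 h2
  rw [h1, h2, ContinuousLinearMap.comp_apply, hP]

/-- For positive times the translated orbit is the orbit of `T(t)x`. The leftover piece of the shift
on `(-t, 0]` is invisible to `v`. -/
theorem inner_shift_orbit (hT : T.IsExpStable) (v : L2pos) (t : ℝ≥0) (x : X)
    (y : StrongDual ℂ X) :
    inner ℂ (v : Lp ℂ 2 (volume : Measure ℝ)) (shift t (orbit hT x y))
      = inner ℂ v (orbit hT (T.op t x) y) := by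
  rw [Submodule.coe_inner, L2.inner_def, L2.inner_def]
  refine integral_congr_ae ?_
  have hv := (ae_restrict_iff' measurableSet_Iic).1 ((mem_L2pos_iff _).1 v.2)
  have h := (measurePreserving_add_right (volume : Measure ℝ) t).quasiMeasurePreserving.ae
    (coeFn_orbit hT x y)
  filter_upwards [hv, h, coeFn_shift t (orbit hT x y : Lp ℂ 2 (volume : Measure ℝ)),
    coeFn_orbit hT (T.op t x) y] with s h1 h2 h3 h4
  rcases le_or_gt s 0 with hs | hs
  · rw [h1 hs, Pi.zero_apply, inner_zero_left, inner_zero_left]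
  · rw [h3, h2, h4, orbitFun_of_pos _ _ hs,
      orbitFun_of_pos _ _ (add_pos_of_pos_of_nonneg hs t.coe_nonneg),
      Real.toNNReal_add hs.le t.coe_nonneg, Real.toNNReal_coe, T.op_add_apply]

/-- The boundary function of `e^{tz}` is the modulation corresponding to the left translation by
`t`, so no density is needed. -/
theorem toeplitz_expSymbol (hT : T.IsExpStable) (t : ℝ≥0) (x : X) (y : StrongDual ℂ X) :
    toeplitz (expSymbol t) (orbit hT x y) = orbit hT (T.op t x) y := by
  refine L2pos_ext fun v => ?_
  rw [inner_toeplitz, ← inner_shift_orbit, inner_shift_eq_integral]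
  refine integral_congr_ae (Eventually.of_forall fun ξ => ?_)
  simp only [boundaryFun_expSymbol]
  congr 2
  push_cast
  ring

variable [CompleteSpace X]

/-- The symbol acts as a superposition of left translations with weight `ψ`. Translating an orbit by
`t` replaces its initial value `x` by `T(t)x`, and integration against `ψ` collects these values. -/
theorem toeplitz_orbit (hT : T.IsExpStable) {g : HInf} {ψ : ℝ → ℂ} (hψ : IsDensity ψ)
    (hg : ∀ z : ℂ, z.re < 0 → extZero g.1 z = ∫ t in Ioi 0, ψ t * Complex.exp (z * t))
    (x : X) (y : StrongDual ℂ X) :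
    toeplitz g (orbit hT x y) = orbit hT (laplaceOp hT hψ x) y := by
  refine L2pos_ext fun v => ?_
  obtain ⟨C, hC⟩ := hψ.2
  let ℓ : X →L[ℂ] ℂ := innerSL ℂ v ∘L orbitL hT y
  have hℓ : ∀ x, ℓ x = inner ℂ v (orbit hT x y) := fun x => rfl
  rw [inner_toeplitz, ← hℓ, map_laplaceOp]
  refine tendsto_nhds_unique (tendsto_integral_inner_shift hψ.1 hC hg v (orbit hT x y)) ?_
  have hi : IntegrableOn (fun t : ℝ => ψ t • ℓ (T.op t.toNNReal x)) (Ioi 0) := by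
    have := ℓ.integrable_comp (integrableOn_smul_op hT hψ x)
    simp only [map_smul] at this
    exact this
  have hshift : ∀ t : ℝ, 0 < t → inner ℂ (v : Lp ℂ 2 (volume : Measure ℝ)) (shift t (orbit hT x y))
      = ℓ (T.op t.toNNReal x) := by
    intro t ht
    rw [hℓ, ← inner_shift_orbit, Real.coe_toNNReal t ht.le]
  -- The regularising weight `exp(st)` can be removed, because exponential stability makes the
  -- integrand absolutely integrable without it.
  have h1 : Tendsto (fun s : ℝ => ∫ t in Ioi (0 : ℝ),
      Complex.exp (s * t) * (ψ t • ℓ (T.op t.toNNReal x)))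
      (𝓝[<] 0) (𝓝 (∫ t in Ioi (0 : ℝ), ψ t • ℓ (T.op t.toNNReal x))) := by
    refine tendsto_integral_filter_of_dominated_convergence
      (fun t => ‖ψ t • ℓ (T.op t.toNNReal x)‖)
      (Eventually.of_forall fun s => ?_) ?_ hi.norm (Eventually.of_forall fun t => ?_)
    · exact AEStronglyMeasurable.mul (by fun_prop) hi.aestronglyMeasurable
    · filter_upwards [self_mem_nhdsWithin] with s hs
      filter_upwards [ae_restrict_mem measurableSet_Ioi] with t ht
      rw [norm_mul, cexp_mul_norm, Complex.ofReal_re]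
      refine mul_le_of_le_one_left (norm_nonneg _) (Real.exp_le_one_iff.2 ?_)
      exact mul_nonpos_of_nonpos_of_nonneg (le_of_lt hs) (le_of_lt ht)
    · have h2 : Tendsto (fun s : ℝ => Complex.exp (s * t)) (𝓝[<] 0)
          (𝓝 (Complex.exp ((0 : ℝ) * t))) :=
        (Continuous.tendsto (by fun_prop) 0).mono_left nhdsWithin_le_nhds
      simpa using h2.mul_const (ψ t • ℓ (T.op t.toNNReal x))
  refine h1.congr fun s => setIntegral_congr_fun measurableSet_Ioi fun t ht => ?_
  rw [hshift t ht, smul_eq_mul]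
  ring

theorem extZero_resolventSymbol {μ : ℂ} (hμ : 0 < μ.re) {z : ℂ} (hz : z.re < 0) :
    extZero (resolventSymbol μ hμ).1 z
      = ∫ t : ℝ in Ioi 0, Complex.exp (-μ * t) * Complex.exp (z * t) := by
  have h1 : (z - μ).re < 0 := by rw [Complex.sub_re]; linarith
  have h2 := integral_exp_mul_complex_Ioi h1 0
  have h3 : ∀ t : ℝ, Complex.exp (-μ * t) * Complex.exp (z * t) = Complex.exp ((z - μ) * t) := by
    intro t
    rw [← Complex.exp_add]
    congr 1
    ring
  simp only [h3]
  rw [h2, extZero_of_neg _ hz]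
  change 1 / (μ - z) = _
  rw [Complex.ofReal_zero, mul_zero, Complex.exp_zero, ← neg_sub μ z, div_neg, neg_div, neg_neg]

theorem toeplitz_resolventSymbol (hT : T.IsExpStable) {μ : ℂ} (hμ : 0 < μ.re) (x : X)
    (y : StrongDual ℂ X) :
    toeplitz (resolventSymbol μ hμ) (orbit hT x y) = orbit hT (resOp hT hμ x) y :=
  toeplitz_orbit hT (isDensity_exp hμ) (fun _ hz => extZero_resolventSymbol hμ hz) x y

/-- The number `⟨y, R(1,A)x⟩` is the Laplace transform of the orbit at `1`, an `L²` inner product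
with `exp(-t)`. Bounds for orbits in `L²` thus become bounds in `X`. -/
theorem exists_norm_dual_resOp_le (hT : T.IsExpStable) (h1 : 0 < (1 : ℂ).re) :
    ∃ c : ℝ, 0 ≤ c ∧ ∀ (x : X) (y : StrongDual ℂ X), ‖y (resOp hT h1 x)‖ ≤ c * ‖orbit hT x y‖ := by
  have hm := memLp_expFun (show (-1 : ℝ) < 0 by norm_num)
  refine ⟨‖hm.toLp _‖, norm_nonneg _, fun x y => ?_⟩
  have h2 : y (resOp hT h1 x) = inner ℂ (hm.toLp _) (orbit hT x y : Lp ℂ 2 (volume : Measure ℝ)) := by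
    rw [resOp, map_laplaceOp, L2.inner_def]
    refine Eq.trans ?_ (setIntegral_eq_integral_of_ae_compl_eq_zero (s := Ioi (0 : ℝ)) ?_)
    · refine integral_congr_ae ?_
      filter_upwards [ae_restrict_of_ae hm.coeFn_toLp, coeFn_orbit_restrict hT x y,
        ae_restrict_mem measurableSet_Ioi] with t h3 h4 ht
      rw [h3, h4, indicator_of_mem ht, RCLike.inner_apply, ← Complex.exp_conj, smul_eq_mul,
        mul_comm]
      simp
    · filter_upwards [hm.coeFn_toLp] with t h3 ht
      rw [h3, indicator_of_notMem ht, inner_zero_left]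
  rw [h2]
  exact norm_inner_le_norm _ _

end Orbit

/-! ### Existence and uniqueness of the calculus operator -/

section Calculus

variable {X : Type*} [NormedAddCommGroup X] [NormedSpace ℂ X] {T : C0Semigroup X}

/-- Continuity in the graph norm along orbits makes pointwise evaluation of the defining almost
everywhere identity legitimate, in particular at `t = 0`. -/
theorem IsCalculusOp.continuous_op {hT : T.IsExpStable} {g : HInf}
    {C : T.generator.domain →ₗ[ℂ] X} (hC : IsCalculusOp hT g C) (x : T.generator.domain) :
    Continuous fun t : ℝ => C ⟨T.op t.toNNReal x, T.op_mem_domain t.toNNReal x⟩ := by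
  obtain ⟨c, hc⟩ := hC.1
  refine continuous_iff_continuousAt.2 fun t₀ => ?_
  have h1 := T.continuous_real_orbit (x : X)
  have h2 := T.continuous_real_orbit (T.generator x)
  have h3 : Continuous fun t : ℝ => c * (‖T.op t.toNNReal x - T.op t₀.toNNReal x‖
      + ‖T.op t.toNNReal (T.generator x) - T.op t₀.toNNReal (T.generator x)‖) := by
    fun_prop
  have h4 := h3.tendsto t₀
  simp only [sub_self, norm_zero, add_zero, mul_zero] at h4
  rw [ContinuousAt, tendsto_iff_norm_sub_tendsto_zero]
  refine squeeze_zero (fun t => norm_nonneg _) (fun t => ?_) h4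
  rw [← map_sub]
  refine (hc _).trans (le_of_eq ?_)
  rw [LinearPMap.map_sub, T.generator_op, T.generator_op]
  rfl

/-- Operators with the characterizing property are determined by the Toeplitz operator. -/
theorem IsCalculusOp.dual_apply_eq {hT : T.IsExpStable} {g g' : HInf}
    {C C' : T.generator.domain →ₗ[ℂ] X} (hC : IsCalculusOp hT g C) (hC' : IsCalculusOp hT g' C')
    {x x' : T.generator.domain} {y y' : StrongDual ℂ X}
    (h : toeplitz g (orbit hT x y) = toeplitz g' (orbit hT x' y')) : y (C x) = y' (C' x') := by
  have h1 := hC.2 x y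
  rw [h] at h1
  have h2 := h1.symm.trans (hC'.2 x' y')
  have c1 := y.continuous.comp (hC.continuous_op x)
  have c2 := y'.continuous.comp (hC'.continuous_op x')
  have h3 := Measure.eqOn_open_of_ae_eq h2 isOpen_Ioi c1.continuousOn c2.continuousOn
  have h4 := h3.closure c1 c2
  rw [closure_Ioi] at h4
  have h5 := h4 (show (0 : ℝ) ∈ Ici 0 by simp)
  simpa [T.op_zero_apply] using h5

theorem eq_of_forall_dual_eq {x x' : X} (h : ∀ y : StrongDual ℂ X, y x = y x') : x = x' :=
  (SeparatingDual.eq_iff_forall_dual_eq (R := ℂ)).2 h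

theorem IsCalculusOp.unique {hT : T.IsExpStable} {g : HInf} {C C' : T.generator.domain →ₗ[ℂ] X}
    (hC : IsCalculusOp hT g C) (hC' : IsCalculusOp hT g C') : C = C' :=
  LinearMap.ext fun _ => eq_of_forall_dual_eq fun _ => hC.dual_apply_eq hC' rfl

/-- The orbit of `x` tested with `y ∘ P` is the orbit of `Px` tested with `y`, so the Toeplitz
operator cannot tell the two sides apart. -/
theorem IsCalculusOp.comm {hT : T.IsExpStable} {g : HInf} {C : T.generator.domain →ₗ[ℂ] X}
    (hC : IsCalculusOp hT g C) {P : X →L[ℂ] X} (hP : ∀ t x, P (T.op t x) = T.op t (P x))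
    (x : T.generator.domain) (hx : P x ∈ T.generator.domain) : C ⟨P x, hx⟩ = P (C x) :=
  eq_of_forall_dual_eq fun y =>
    hC.dual_apply_eq (x' := x) (y' := y ∘L P) hC (by rw [orbit_comp hT hP])

/-- A bounded operator which represents the Toeplitz operator on orbits restricts to the calculus
operator. -/
theorem isCalculusOp_of_toeplitz_eq (hT : T.IsExpStable) {g : HInf} {P : X →L[ℂ] X}
    (hP : ∀ t x, P (T.op t x) = T.op t (P x))
    (h : ∀ (x : T.generator.domain) (y : StrongDual ℂ X),
      toeplitz g (orbit hT x y) = orbit hT (P x) y) :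
    IsCalculusOp hT g (P.toLinearMap ∘ₗ T.generator.domain.subtype) := by
  refine ⟨⟨‖P‖, fun x => ?_⟩, fun x y => ?_⟩
  · refine (P.le_opNorm _).trans ?_
    gcongr
    exact le_add_of_nonneg_right (norm_nonneg _)
  · rw [h]
    filter_upwards [coeFn_orbit_restrict hT (P x) y] with t ht
    rw [ht, ← hP]
    rfl

/-! ### The Lambda extension -/

theorem calculus_mem_of_tendsto {hT : T.IsExpStable} {g : HInf} {x z : X}
    (h : Tendsto (fun s : ℝ => (s : ℂ) • calculusOp hT g (res T.generator s x)) atTop (𝓝 z)) :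
    ∃ hx : x ∈ (calculus hT g).domain, calculus hT g ⟨x, hx⟩ = z :=
  ⟨⟨z, h⟩, h.limUnder_eq⟩

theorem tendsto_calculus {hT : T.IsExpStable} {g : HInf} (x : (calculus hT g).domain) :
    Tendsto (fun s : ℝ => (s : ℂ) • calculusOp hT g (res T.generator s x)) atTop
      (𝓝 (calculus hT g x)) :=
  tendsto_nhds_limUnder x.2

theorem calculus_eq_of_forall {hT : T.IsExpStable} {g : HInf} {F : X →ₗ[ℂ] X}
    (h : ∀ x, Tendsto (fun s : ℝ => (s : ℂ) • calculusOp hT g (res T.generator s x)) atTop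
      (𝓝 (F x))) : calculus hT g = F.toPMap ⊤ := by
  refine LinearPMap.ext ?_ fun x hx hx' => ?_
  · rw [LinearMap.toPMap_domain, eq_top_iff]
    exact fun x _ => (calculus_mem_of_tendsto (h x)).1
  · obtain ⟨_, h2⟩ := calculus_mem_of_tendsto (h x)
    rw [h2]
    rfl

theorem ofBounded_injective : Function.Injective (ofBounded : (X →L[ℂ] X) → X →ₗ.[ℂ] X) :=
  fun _ _ h => ContinuousLinearMap.ext fun x =>
    (LinearPMap.ext_iff.1 h).2 (x := x) (hf := trivial) (hg := trivial)

variable [CompleteSpace X]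

theorem re_one_pos : 0 < (1 : ℂ).re := by simp

/-- There is a bounded operator which acts as `g(A) R(1, A)`. -/
theorem exists_regularized_op (hT : T.IsExpStable) (g : HInf) :
    ∃ B : X →L[ℂ] X, (∀ t x, B (T.op t x) = T.op t (B x)) ∧
      ∀ x y, toeplitz g (orbit hT (resOp hT re_one_pos x) y) = orbit hT (B x) y := by
  set R := resOp hT re_one_pos with hR
  have hRT : ∀ t x, R (T.op t x) = T.op t (R x) := laplaceOp_op hT _
  set r := resolventSymbol 1 re_one_pos with hr
  obtain ⟨c, hc⟩ := g.2.2
  have hc0 : 0 ≤ c := (norm_nonneg _).trans (hc ⟨-1, by simp⟩)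
  -- Two resolvent factors are needed to give `g` quadratic decay; `C₀` below then plays the role of
  -- `g(A)R²`.
  obtain ⟨ψ, hψ, ⟨C, hC⟩, hψk⟩ := exists_laplace_density (g * (r * r)).2.1 (c := c)
    (fun z hz => by
      rw [extZero_of_neg _ hz]
      change ‖g.1 ⟨z, hz⟩ * (1 / (1 - z) * (1 / (1 - z)))‖ ≤ _
      rw [norm_mul]
      refine mul_le_mul (hc _) ?_ (norm_nonneg _) hc0
      rw [norm_mul, norm_div, norm_one, ← sq, div_pow, one_pow, one_div]
      exact inv_anti₀ (by positivity) (normSq_one_sub hz))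
  have hψd : IsDensity ψ := ⟨hψ, C, fun t _ => hC t⟩
  set C₀ := laplaceOp hT hψd with hC₀
  have hC₀T : ∀ t x, C₀ (T.op t x) = T.op t (C₀ x) := laplaceOp_op hT hψd
  have hRC : ∀ x, R (C₀ x) = C₀ (R x) := fun x => laplaceOp_comm hT hψd hRT x
  have hk : ∀ z y, toeplitz g (orbit hT (R (R z)) y) = orbit hT (C₀ z) y := by
    intro z y
    rw [← toeplitz_orbit hT hψd hψk, toeplitz_mul, toeplitz_mul, toeplitz_resolventSymbol,
      toeplitz_resolventSymbol]
  obtain ⟨c₁, hc₁, hc₁'⟩ := exists_norm_orbit_le hT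
  obtain ⟨c₂, hc₂, hc₂'⟩ := exists_norm_dual_resOp_le hT re_one_pos
  -- The functional estimate uses up one factor `R`, which is why it is applied to `R(C₀ z)`.
  -- Afterwards `C₀ z` appears only through its orbit, which is `M_g` of the orbit of `R(Rz)`.
  have hbound : ∀ z, ‖C₀ (R z)‖ ≤ c₂ * (‖toeplitzL g‖ * c₁) * ‖R (R z)‖ := by
    intro z
    refine NormedSpace.norm_le_dual_bound ℂ _ (by positivity) fun y => ?_
    calc ‖y (C₀ (R z))‖ = ‖y (R (C₀ z))‖ := by rw [hRC]
      _ ≤ c₂ * ‖orbit hT (C₀ z) y‖ := hc₂' _ _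
      _ = c₂ * ‖toeplitzL g (orbit hT (R (R z)) y)‖ := by rw [toeplitzL_apply, hk]
      _ ≤ c₂ * (‖toeplitzL g‖ * (c₁ * ‖y‖ * ‖R (R z)‖)) := by
          gcongr
          exact ((toeplitzL g).le_opNorm _).trans (by gcongr; exact hc₁' _ _)
      _ = _ := by ring
  have hRd : DenseRange R := denseRange_resOp hT re_one_pos
  have hRRd : DenseRange (R ∘L R) := hRd.comp hRd R.continuous
  -- By the bound, `R²z ↦ C₀Rz` is well defined and bounded on the dense range of `R²`. Its
  -- extension satisfies `BR = C₀` by density.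
  let B := LinearMap.extendOfNorm (C₀ ∘L R).toLinearMap (R ∘L R).toLinearMap
  have hB : ∀ z, B (R (R z)) = C₀ (R z) := fun z =>
    LinearMap.extendOfNorm_eq (f := (C₀ ∘L R).toLinearMap) (e := (R ∘L R).toLinearMap) hRRd
      ⟨_, hbound⟩ z
  have hBR : ∀ z, B (R z) = C₀ z := fun z =>
    congrFun (hRd.equalizer (B.continuous.comp R.continuous) C₀.continuous
      (funext fun z => hB z)) z
  refine ⟨B, fun t x => ?_, fun x y => ?_⟩
  · refine congrFun (hRd.equalizer (B.continuous.comp (T.op t).continuous)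
      ((T.op t).continuous.comp B.continuous) (funext fun z => ?_)) x
    simp only [Function.comp_apply]
    rw [← hRT, hBR, hBR, hC₀T]
  · refine congrFun (hRd.equalizer (g := fun x => toeplitzL g (orbitL hT y (R x)))
      (h := fun x => orbitL hT y (B x)) (by fun_prop) (by fun_prop) (funext fun z => ?_)) x
    simp only [Function.comp_apply, toeplitzL_apply, orbitL_apply]
    rw [hk, hBR]

theorem exists_isCalculusOp (hT : T.IsExpStable) (g : HInf) : ∃ C, IsCalculusOp hT g C := by
  obtain ⟨B, hBT, hB⟩ := exists_regularized_op hT g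
  -- As `B` stands for `g(A)R(1,A)`, the operator sought is `B(1 - A)`, whose graph norm bound is
  -- that of `1 - A`.
  refine ⟨B.toLinearMap ∘ₗ subOp T.generator 1, ⟨‖B‖, fun x => ?_⟩, fun x y => ?_⟩
  · refine (B.le_opNorm _).trans ?_
    gcongr
    rw [subOp_apply, one_smul]
    exact norm_sub_le _ _
  · have h1 := hB (subOp T.generator 1 x) y
    rw [resOp_subOp] at h1
    rw [h1]
    filter_upwards [coeFn_orbit_restrict hT (B (subOp T.generator 1 x)) y] with t ht
    rw [ht, ← hBT]
    simp only [LinearMap.comp_apply, ContinuousLinearMap.coe_coe, subOp_apply, T.generator_op,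
      one_smul, map_sub]

theorem isCalculusOp_calculusOp (hT : T.IsExpStable) (g : HInf) :
    IsCalculusOp hT g (calculusOp hT g) :=
  Classical.epsilon_spec (exists_isCalculusOp hT g)

theorem IsCalculusOp.eq_calculusOp {hT : T.IsExpStable} {g : HInf}
    {C : T.generator.domain →ₗ[ℂ] X} (hC : IsCalculusOp hT g C) : C = calculusOp hT g :=
  hC.unique (isCalculusOp_calculusOp hT g)

/-! ### Bounded Lambda extensions -/

theorem resOp_comm (hT : T.IsExpStable) {μ : ℂ} (hμ : 0 < μ.re) {P : X →L[ℂ] X}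
    (hP : ∀ t x, P (T.op t x) = T.op t (P x)) (x : X) :
    P (resOp hT hμ x) = resOp hT hμ (P x) :=
  laplaceOp_comm hT (isDensity_exp hμ) hP x

/-- The Lambda extension extends `g(A)`. -/
theorem tendsto_calculusOp (hT : T.IsExpStable) (g : HInf) (x : T.generator.domain) :
    Tendsto (fun s : ℝ => (s : ℂ) • calculusOp hT g (res T.generator s x)) atTop
      (𝓝 (calculusOp hT g x)) := by
  -- On `D(A)` the resolvent commutes with `g(A)`, so the approximants are `sR(s,A)` applied to
  -- `g(A)x`.
  refine (tendsto_smul_resOp hT (calculusOp hT g x)).congr' ?_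
  filter_upwards [eventually_gt_atTop 0] with s hs
  have hs' : 0 < (s : ℂ).re := by simpa using hs
  rw [res_eq_resOp hT hs', res_eq_resOp hT hs']
  congr 1
  exact ((isCalculusOp_calculusOp hT g).comm
    (fun t x => laplaceOp_op hT (isDensity_exp hs') t x) x _).symm

/-- `g_Λ(A)` is the bounded operator `P` if and only if `g(A)` is a restriction of `P`. -/
theorem calculus_eq_ofBounded_iff (hT : T.IsExpStable) (g : HInf) (P : X →L[ℂ] X) :
    calculus hT g = ofBounded P ↔ ∀ x : T.generator.domain, calculusOp hT g x = P x := by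
  constructor
  · intro h x
    have h1 : Tendsto (fun s : ℝ => (s : ℂ) • calculusOp hT g (res T.generator s x)) atTop
        (𝓝 (P x)) := by
      have hx : (x : X) ∈ (calculus hT g).domain := by rw [h]; trivial
      have h2 := tendsto_calculus ⟨(x : X), hx⟩
      have h3 : calculus hT g ⟨(x : X), hx⟩ = P x :=
        (LinearPMap.ext_iff.1 h).2 (x := (x : X)) (hf := hx) (hg := trivial)
      rwa [h3] at h2
    exact tendsto_nhds_unique (tendsto_calculusOp hT g x) h1
  · intro h
    refine calculus_eq_of_forall fun x => ?_
    refine ((P.continuous.tendsto x).comp (tendsto_smul_resOp hT x)).congr fun s => ?_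
    simp only [Function.comp_apply, map_smul, h]

/-- `g(A)` commutes with the semigroup on the range of the resolvent, and boundedness of `P` extends
this by density. -/
theorem comm_of_calculusOp_eq (hT : T.IsExpStable) {g : HInf} {P : X →L[ℂ] X}
    (hP : ∀ x : T.generator.domain, calculusOp hT g x = P x) (t : ℝ≥0) (x : X) :
    P (T.op t x) = T.op t (P x) := by
  refine congrFun ((denseRange_resOp hT re_one_pos).equalizer
    (P.continuous.comp (T.op t).continuous) ((T.op t).continuous.comp P.continuous)
    (funext fun z => ?_)) x
  have h1 := hP ⟨_, (resOp_mem_domain hT re_one_pos z).1⟩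
  have h2 := hP ⟨_, T.op_mem_domain t ⟨_, (resOp_mem_domain hT re_one_pos z).1⟩⟩
  simp only [Function.comp_apply]
  rw [← h1, ← h2]
  exact (isCalculusOp_calculusOp hT g).comm (fun s x => T.op_comm t s x)
    ⟨_, (resOp_mem_domain hT re_one_pos z).1⟩ _

/-- The common criterion for products, sums, constants, resolvents and exponentials: it suffices to
exhibit a bounded operator commuting with the semigroup that reproduces the Toeplitz operator on
orbits. -/
theorem calculus_eq_ofBounded_of_toeplitz_eq (hT : T.IsExpStable) {g : HInf} {P : X →L[ℂ] X}
    (hP : ∀ t x, P (T.op t x) = T.op t (P x))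
    (h : ∀ (x : T.generator.domain) (y : StrongDual ℂ X),
      toeplitz g (orbit hT x y) = orbit hT (P x) y) : calculus hT g = ofBounded P := by
  rw [calculus_eq_ofBounded_iff, ← (isCalculusOp_of_toeplitz_eq hT hP h).eq_calculusOp]
  exact fun x => rfl

/-- Both sides are continuous in `x`, so the identity extends from `D(A)` to `X`. In this form two
such identities compose freely. -/
theorem toeplitz_orbit_of_calculusOp_eq (hT : T.IsExpStable) {g : HInf} {P : X →L[ℂ] X}
    (h : ∀ x : T.generator.domain, calculusOp hT g x = P x) (x : X) (y : StrongDual ℂ X) :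
    toeplitz g (orbit hT x y) = orbit hT (P x) y := by
  refine congrFun ((denseRange_resOp hT re_one_pos).equalizer
    (g := fun x => toeplitzL g (orbitL hT y x)) (h := fun x => orbitL hT y (P x))
    (by fun_prop) (by fun_prop) (funext fun z => ?_)) x
  refine L2pos_ext_ae ?_
  simp only [Function.comp_apply, toeplitzL_apply, orbitL_apply]
  refine ((isCalculusOp_calculusOp hT g).2 ⟨_, (resOp_mem_domain hT re_one_pos z).1⟩ y).trans ?_
  filter_upwards [coeFn_orbit_restrict hT (P (resOp hT re_one_pos z)) y] with t ht
  rw [ht, h, comm_of_calculusOp_eq hT h]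

theorem calculus_mul (hT : T.IsExpStable) {f g : HInf} {P Q : X →L[ℂ] X}
    (hf : calculus hT f = ofBounded P) (hg : calculus hT g = ofBounded Q) :
    calculus hT (f * g) = ofBounded (P * Q) := by
  rw [calculus_eq_ofBounded_iff] at hf hg
  refine calculus_eq_ofBounded_of_toeplitz_eq hT (fun t x => ?_) fun x y => ?_
  · rw [mul_apply_eq_comp, mul_apply_eq_comp, comm_of_calculusOp_eq hT hg,
      comm_of_calculusOp_eq hT hf]
  · rw [toeplitz_mul, toeplitz_orbit_of_calculusOp_eq hT hg,
      toeplitz_orbit_of_calculusOp_eq hT hf, mul_apply_eq_comp]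

theorem calculus_add (hT : T.IsExpStable) {f g : HInf} {P Q : X →L[ℂ] X}
    (hf : calculus hT f = ofBounded P) (hg : calculus hT g = ofBounded Q) :
    calculus hT (f + g) = ofBounded (P + Q) := by
  rw [calculus_eq_ofBounded_iff] at hf hg
  refine calculus_eq_ofBounded_of_toeplitz_eq hT (fun t x => ?_) fun x y => ?_
  · rw [add_apply, add_apply, map_add,
      comm_of_calculusOp_eq hT hg, comm_of_calculusOp_eq hT hf]
  · rw [toeplitz_add, toeplitz_orbit_of_calculusOp_eq hT hg,
      toeplitz_orbit_of_calculusOp_eq hT hf, ← orbit_add]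
    rfl

theorem calculus_algebraMap (hT : T.IsExpStable) (c : ℂ) :
    calculus hT (algebraMap ℂ HInf c) = ofBounded (algebraMap ℂ (X →L[ℂ] X) c) := by
  refine calculus_eq_ofBounded_of_toeplitz_eq hT (fun t x => ?_) fun x y => ?_
  · simp [Algebra.algebraMap_eq_smul_one]
  · rw [toeplitz_algebraMap, ← orbit_smul]
    simp [Algebra.algebraMap_eq_smul_one]

/-- The symbols `g` for which `g_Λ(A)` is bounded. -/
def boundedSymbols (hT : T.IsExpStable) : Subalgebra ℂ HInf where
  carrier := {g | ∃ P : X →L[ℂ] X, calculus hT g = ofBounded P}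
  mul_mem' := fun ⟨_, hP⟩ ⟨_, hQ⟩ => ⟨_, calculus_mul hT hP hQ⟩
  add_mem' := fun ⟨_, hP⟩ ⟨_, hQ⟩ => ⟨_, calculus_add hT hP hQ⟩
  algebraMap_mem' := fun c => ⟨_, calculus_algebraMap hT c⟩

theorem calculus_boundedSymbols (hT : T.IsExpStable) (g : boundedSymbols hT) :
    calculus hT (g : HInf) = ofBounded g.2.choose := g.2.choose_spec

/-- The functional calculus on the symbols `g` for which `g_Λ(A)` is bounded. -/
def boundedCalculus (hT : T.IsExpStable) : boundedSymbols hT →ₐ[ℂ] (X →L[ℂ] X) where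
  -- The chosen operator is the only one possible, by `ofBounded_injective`, so every algebra law
  -- follows from the corresponding rule for `calculus`.
  toFun := fun g => g.2.choose
  map_one' := ofBounded_injective <| by
    rw [← calculus_boundedSymbols, ← map_one (algebraMap ℂ (X →L[ℂ] X)), ← calculus_algebraMap hT,
      map_one]
    rfl
  map_mul' := fun f g => ofBounded_injective <| by
    rw [← calculus_boundedSymbols]
    exact calculus_mul hT (calculus_boundedSymbols hT f) (calculus_boundedSymbols hT g)
  map_zero' := ofBounded_injective <| by
    rw [← calculus_boundedSymbols, ← map_zero (algebraMap ℂ (X →L[ℂ] X)),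
      ← calculus_algebraMap hT, map_zero]
    rfl
  map_add' := fun f g => ofBounded_injective <| by
    rw [← calculus_boundedSymbols]
    exact calculus_add hT (calculus_boundedSymbols hT f) (calculus_boundedSymbols hT g)
  commutes' := fun c => ofBounded_injective <| by
    rw [← calculus_boundedSymbols, ← calculus_algebraMap hT]
    rfl

/-- `P` commutes with `R(s,A)` and with `g(A)`, hence with every approximant `s g(A)R(s,A)` for `s >
0`. Continuity of `P` carries this to the limit and shows that the limit at `Px` exists. -/
theorem commutesWith_calculus (hT : T.IsExpStable) {P : X →L[ℂ] X}
    (hP : ∀ t x, P (T.op t x) = T.op t (P x)) (g : HInf) : CommutesWith P (calculus hT g) := by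
  intro x
  refine calculus_mem_of_tendsto (((P.continuous.tendsto _).comp (tendsto_calculus x)).congr' ?_)
  filter_upwards [eventually_gt_atTop 0] with s hs
  have hs' : 0 < (s : ℂ).re := by simpa using hs
  simp only [Function.comp_apply, map_smul]
  congr 1
  rw [res_eq_resOp hT hs', res_eq_resOp hT hs']
  have h1 := (T.commutesWith_of_comm hP ⟨_, (resOp_mem_domain hT hs' x).1⟩).1
  rw [← (isCalculusOp_calculusOp hT g).comm hP _ h1]
  congr 2
  exact resOp_comm hT hs' hP x

theorem calculus_resolventSymbol (hT : T.IsExpStable) {μ : ℂ} (hμ : 0 < μ.re) :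
    calculus hT (resolventSymbol μ hμ) =
      (T.generator.domain.subtype ∘ₗ res T.generator μ).toPMap ⊤ := by
  rw [calculus_eq_ofBounded_of_toeplitz_eq hT (P := resOp hT hμ)
    (fun t x => laplaceOp_op hT (isDensity_exp hμ) t x)
    fun x y => toeplitz_resolventSymbol hT hμ x y, ofBounded]
  congr 1
  ext x
  rw [LinearMap.comp_apply, res_eq_resOp hT hμ]
  rfl

theorem calculus_expSymbol (hT : T.IsExpStable) (t : ℝ≥0) :
    calculus hT (expSymbol t) = ofBounded (T.op t) :=
  calculus_eq_ofBounded_of_toeplitz_eq hT (fun s x => T.op_comm t s x)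
    fun x y => toeplitz_expSymbol hT t x y

end Calculus

end HInfCalculus

end

theorem theorem2p14 {X : Type*} [NormedAddCommGroup X] [NormedSpace ℂ X] [CompleteSpace X]
    (T : C0Semigroup X) (hT : T.IsExpStable) :
    -- the operators `g(A)` are well defined by their characterizing property
    (∀ g : HInf, IsCalculusOp hT g (calculusOp hT g) ∧
      ∀ C, IsCalculusOp hT g C → C = calculusOp hT g) ∧
    -- the `g` with `g_Λ(A)` bounded form an algebra, and `g ↦ g_Λ(A)` is a homomorphism on it
    (∃ (S : Subalgebra ℂ HInf) (Φ : S →ₐ[ℂ] (X →L[ℂ] X)),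
      (∀ g : HInf, g ∈ S ↔ ∃ P : X →L[ℂ] X, calculus hT g = ofBounded P) ∧
      ∀ g : S, calculus hT (g : HInf) = ofBounded (Φ g)) ∧
    -- bounded operators commuting with `A` commute with `g_Λ(A)`
    (∀ P : X →L[ℂ] X, CommutesWith P T.generator →
      ∀ g : HInf, CommutesWith P (calculus hT g)) ∧
    (∀ (t : ℝ≥0) (g : HInf), CommutesWith (T.op t) (calculus hT g)) ∧
    -- `z ↦ 1 / (μ - z)` gives the resolvent
    (∀ (μ : ℂ) (hμ : 0 < μ.re), μ ∈ resSet T.generator ∧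
      calculus hT (resolventSymbol μ hμ) =
        (T.generator.domain.subtype ∘ₗ res T.generator μ).toPMap ⊤) ∧
    -- `z ↦ exp (t z)` gives the semigroup
    (∀ t : ℝ≥0, calculus hT (expSymbol t) = ofBounded (T.op t)) := by
  refine ⟨fun g => ⟨isCalculusOp_calculusOp hT g, fun C hC => hC.eq_calculusOp⟩,
    ⟨boundedSymbols hT, boundedCalculus hT, fun g => Iff.rfl, calculus_boundedSymbols hT⟩,
    fun P hP => commutesWith_calculus hT (op_comm_of_commutesWith hT hP),
    fun t => commutesWith_calculus hT (fun s x => T.op_comm t s x),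
    fun μ hμ => ⟨mem_resSet hT hμ, calculus_resolventSymbol hT hμ⟩, calculus_expSymbol hT⟩
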